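/- For $a,b,c\in\mathbb C$ let $\mathbf F(a,b;c;z)$ denote the regularized (Olver) hypergeometric function, i.e. the analytic continuation to $\mathbb C\setminus[1,\infty)$ of $\sum_{n=0}^\infty \frac{(a)_n(b)_n}{\Gamma(c+n)\,n!}z^n$, $|z|<1$; thus $\mathbf F(a,b;c;z)={}_2F_1(a,b;c;z)/\Gamma(c)$ if $c\notin\{0,-1,-2,\dots\}$, where ${}_2F_1$ is the principal branch, continued from the unit disk to the same cut plane. For $\nu,\mu\in\mathbb C$ and $x\in\mathbb C\setminus((-\infty,-1]\cup[1,\infty))$ the Ferrers function of the first kind is $$\mathsf P_\nu^\mu(x)=\Big(\frac{1+x}{1-x}\Big)^{\mu/2}\,\mathbf F\Big(\nu+1,-\nu;1-\mu;\frac{1-x}{2}\Big).$$ All powers and square roots are principal. **Theorem.** Let $x\in\mathbb C\setminus((-\infty,-1]\cup[1,\infty))$ and let $\nu,\mu\in\mathbb C$ with $\nu+\mu\notin\{-1,-2,-3,\dots\}$. Put $u=x+i\sqrt{1-x^2}$ and $v=x-i\sqrt{1-x^2}$. Then $v=1/u$, both $u/v$ and $v/u$ lie in $\mathbb C\setminus[1,\infty)$,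 and $$\mathsf P_\nu^\mu(x)=\frac{2^\mu}{i\sqrt\pi}(1-x^2)^{\frac12\mu}\,\frac{\Gamma(\nu+\mu+1)}{\Gamma(\nu+\frac32)}\Big(u^{\nu+\mu+1}{}_2F_1\big(\mu+\tfrac12,\nu+\mu+1;\nu+\tfrac32;\tfrac uv\big)-v^{\nu+\mu+1}{}_2F_1\big(\mu+\tfrac12,\nu+\mu+1;\nu+\tfrac32;\tfrac vu\big)\Big),$$ where, if $\nu+\frac32\in\{0,-1,-2,\dots\}$, the quotients ${}_2F_1(\dots;\nu+\frac32;\cdot)/\Gamma(\nu+\frac32)$ are read as $\mathbf F(\mu+\frac12,\nu+\mu+1;\nu+\frac32;\cdot)$. -/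

import Mathlib

/-- The complex plane cut along `[1, ∞)`, the domain of the principal branch of the Gauss
hypergeometric function. -/
def cutPlane : Set ℂ := (((↑) : ℝ → ℂ) '' Set.Ici 1)ᶜ

open Classical in
/-- The analytic continuation to the cut plane `ℂ \ [1, ∞)` of a function `f` given on the open unit
disk (`0` if there is no such continuation). Only its values on the cut plane are meaningful;
there it is unique by `cutContinuation_eq`. -/
noncomputable def cutContinuation (f : ℂ → ℂ) : ℂ → ℂ :=
  if h : ∃ g : ℂ → ℂ, DifferentiableOn ℂ g cutPlane ∧ Set.EqOn g f (Metric.ball 0 1)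
  then h.choose else 0

/-- The cut plane is open. -/
theorem isOpen_cutPlane : IsOpen cutPlane :=
  (Complex.isometry_ofReal.isClosedEmbedding.isClosedMap _ isClosed_Ici).isOpen_compl

/-- The cut plane contains `0`. -/
theorem zero_mem_cutPlane : (0 : ℂ) ∈ cutPlane := by
  rintro ⟨t, ht, h0⟩
  rw [Complex.ofReal_eq_zero] at h0
  subst h0
  exact absurd ht (by norm_num)

/-- The cut plane is star-shaped with respect to `0`. -/
theorem starConvex_cutPlane : StarConvex ℝ 0 cutPlane := by
  rw [starConvex_zero_iff]
  rintro z hz a ha0 ha1 ⟨t, ht, hta⟩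
  have ht1 : (1 : ℝ) ≤ t := ht
  have ha : a ≠ 0 := by
    rintro rfl
    simp only [zero_smul, Complex.ofReal_eq_zero] at hta
    linarith
  have hapos : 0 < a := lt_of_le_of_ne ha0 (Ne.symm ha)
  refine hz ⟨t / a, ?_, ?_⟩
  · exact (one_le_div hapos).2 (ha1.trans ht1)
  · have haC : (a : ℂ) ≠ 0 := Complex.ofReal_ne_zero.2 ha
    rw [Complex.ofReal_div, hta, Complex.real_smul]
    field_simp

/-- The continuation to the cut plane is unique: every analytic function on the cut plane that
agrees with `f` on the unit disk is the continuation of `f`. -/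
theorem cutContinuation_eq {f g : ℂ → ℂ} (hg : DifferentiableOn ℂ g cutPlane)
    (hgf : Set.EqOn g f (Metric.ball 0 1)) : Set.EqOn (cutContinuation f) g cutPlane := by
  have h : ∃ g : ℂ → ℂ, DifferentiableOn ℂ g cutPlane ∧ Set.EqOn g f (Metric.ball 0 1) :=
    ⟨g, hg, hgf⟩
  have hdef : cutContinuation f = h.choose := by
    unfold cutContinuation
    exact dif_pos h
  rw [hdef]
  refine (h.choose_spec.1.analyticOnNhd isOpen_cutPlane).eqOn_of_preconnected_of_eventuallyEq
    (hg.analyticOnNhd isOpen_cutPlane)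
    (starConvex_cutPlane.isPathConnected zero_mem_cutPlane).isConnected.isPreconnected
    zero_mem_cutPlane ?_
  filter_upwards [Metric.ball_mem_nhds (0 : ℂ) one_pos] with z hz
  rw [h.choose_spec.2 hz, hgf hz]

/-- The principal branch of the Gauss hypergeometric function `₂F₁(a, b; c; z)`, for `c` not in
`{0, -1, -2, …}` and `z` in the cut plane `ℂ \ [1, ∞)`: the continuation of the sum of the Gauss
series. -/
noncomputable def gaussF (a b c z : ℂ) : ℂ :=
  cutContinuation (fun w => ordinaryHypergeometric a b c w) z

/-- The principal branch of the regularized (Olver) hypergeometric function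
`∑ (a)ₙ (b)ₙ / (Γ(c + n) n!) zⁿ`, for all complex `a`, `b`, `c` and `z` in the cut plane
`ℂ \ [1, ∞)`. It is `₂F₁(a, b; c; z) / Γ(c)` if `c` is not in `{0, -1, -2, …}`. Since
`Complex.Gamma` is `0` at its poles, the inverse in the series is the entire function `1 / Γ`. -/
noncomputable def regularizedF (a b c z : ℂ) : ℂ :=
  cutContinuation (fun w => ∑' n : ℕ, (ascPochhammer ℂ n).eval a * (ascPochhammer ℂ n).eval b *
    (Complex.Gamma (c + n))⁻¹ / (n.factorial : ℂ) * w ^ n) z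

/-- The Ferrers function of the first kind `P_ν^μ(x)`, for all complex `ν`, `μ` and
`x ∈ ℂ \ ((-∞, -1] ∪ [1, ∞))`, with principal powers. -/
noncomputable def ferrersP (ν μ x : ℂ) : ℂ :=
  ((1 + x) / (1 - x)) ^ (μ / 2) * regularizedF (ν + 1) (-ν) (1 - μ) ((1 - x) / 2)

/-!
Why the formula holds. The map `x = sin φ` identifies the doubly cut plane with the strip
`|Re φ| < π / 2`, and there `√(1 - x²) = cos φ`, `u = i exp (-i φ)`, `v = -i exp (i φ)`: all
principal powers become exponentials (`exists_angle`, `mul_exp_cpow`).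

Pfaff's transformation `F(a, b; c; z) = (1 - z)^(-a) F(a, c - b; c; z / (z - 1))` turns each
hypergeometric function on the right into a Legendre-type one, with `a + b = 1` and argument
`(1 ∓ i tan φ) / 2`, so that the right-hand side becomes a combination of two functions
`whippleAngle` (`unit_cpow_mul_regularizedF`). The left-hand side is of Legendre type from the
start, with argument `(1 - sin φ) / 2`.

Write `X` for either side, and `Y` for the same side with `μ` replaced by `μ + 1`. Both sides solve
the linear system `X' = -μ tan φ X - Y`, `Y' = (ν + μ + 1)(ν - μ) X + (μ + 1) tan φ Y`: on the left
this is a pair of contiguous relations in `c`, on the right a pair of relations that shift `(a, b)`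
to `(a + 1, b - 1)`. At `φ = 0` all hypergeometric functions are taken at `1 / 2`, where Bailey's
theorem evaluates them, and the two sides agree by the duplication and reflection formulas of the
Gamma function (`initial_value`). By Grönwall's inequality along rays they agree on the whole strip
(`linearSystem_eq_zero`, `ferrersAngle_eq`).

The continuation of the Legendre-type series to the cut plane is obtained from Euler's integral when
`Re c > Re b > 0`. The condition `Re b > 0` may be assumed because `a + b = 1`, and the condition on
`c` is removed by the differential operator `z d/dz + c`, which lowers the third parameter from
`c + 1` to `c`; so no analytic continuation in the parameters is needed. Pfaff's transformation then
continues the series on the right.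
-/

open MeasureTheory Set Interval

/-! ### The hypergeometric series -/

/-- The `n`-th Taylor coefficient of the regularized hypergeometric function. -/
noncomputable def olverCoeff (a b c : ℂ) (n : ℕ) : ℂ :=
  (ascPochhammer ℂ n).eval a * (ascPochhammer ℂ n).eval b * (Complex.Gamma (c + n))⁻¹ /
    (n.factorial : ℂ)

/-- The sum of the hypergeometric series of the regularized function, meaningful on the open unit
disk. -/
noncomputable def olverSum (a b c z : ℂ) : ℂ := ∑' n : ℕ, olverCoeff a b c n * z ^ n

/-- The two-term recurrence of the coefficients, free of divisions so that it also holds when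
`c + n = 0`. -/
theorem olverCoeff_succ (a b c : ℂ) (n : ℕ) :
    olverCoeff a b c (n + 1) * ((n + 1) * (c + n)) = olverCoeff a b c n * ((a + n) * (b + n)) := by
  have hG := Complex.one_div_Gamma_eq_self_mul_one_div_Gamma_add_one (c + n)
  have hn : (n.factorial : ℂ) ≠ 0 := Nat.cast_ne_zero.2 n.factorial_ne_zero
  have hn1 : (n + 1 : ℂ) ≠ 0 := Nat.cast_add_one_ne_zero n
  unfold olverCoeff
  rw [hG, ascPochhammer_succ_eval, ascPochhammer_succ_eval, Nat.factorial_succ]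
  push_cast
  rw [add_assoc c]
  field_simp

theorem olverCoeff_add_one_right (a b c : ℂ) (n : ℕ) :
    (c + n) * olverCoeff a b (c + 1) n = olverCoeff a b c n := by
  have hG := Complex.one_div_Gamma_eq_self_mul_one_div_Gamma_add_one (c + n)
  unfold olverCoeff
  rw [hG, add_right_comm c 1 (n : ℂ)]
  ring

theorem olverCoeff_comm (a b c : ℂ) (n : ℕ) : olverCoeff a b c n = olverCoeff b a c n := by
  unfold olverCoeff; ring

theorem olverSum_comm (a b c z : ℂ) : olverSum a b c z = olverSum b a c z := by
  unfold olverSum; simp_rw [olverCoeff_comm a b]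

theorem summable_olver (a b c : ℂ) {z : ℂ} (hz : ‖z‖ < 1) :
    Summable fun n : ℕ => olverCoeff a b c n * z ^ n := by
  have h1 := Complex.radius_regularizedGaussHGFunSeries_ge_one a b c
  refine ((Complex.regularizedGaussHGFunSeries a b c).summable (x := z) ?_).congr fun n => ?_
  · refine Metric.eball_subset_eball h1 ?_
    simpa [Metric.mem_eball, edist_zero_right, enorm_eq_nnnorm, ← NNReal.coe_lt_one] using hz
  · rw [FormalMultilinearSeries.apply_eq_pow_smul_coeff,
      Complex.coeff_regularizedGaussHGFunSeries, olverCoeff, smul_eq_mul]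
    field_simp

/-! ### Power series on the unit disk -/

theorem HasSum.of_eq {f g : ℕ → ℂ} {s t : ℂ} (h : HasSum f s) (hf : ∀ n, g n = f n)
    (hs : t = s) : HasSum g t := by
  rw [hs, funext hf]
  exact h

section PowerSeries

variable {A : ℕ → ℂ}

theorem differentiableOn_powerSeries (hA : ∀ z : ℂ, ‖z‖ < 1 → Summable fun n => A n * z ^ n) :
    DifferentiableOn ℂ (fun z => ∑' n, A n * z ^ n) (Metric.ball 0 1) := by
  intro z hz
  rw [mem_ball_zero_iff] at hz
  obtain ⟨r, hr, hr1⟩ := exists_between hz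
  have hr0 : 0 ≤ r := (norm_nonneg z).trans hr.le
  have hu := (hA r (by simpa [abs_of_nonneg hr0] using hr1)).norm
  refine ((Complex.differentiableOn_tsum_of_summable_norm hu (U := Metric.ball 0 r)
    (fun n => by fun_prop) Metric.isOpen_ball fun n w hw => ?_).differentiableAt
    (Metric.isOpen_ball.mem_nhds (by simpa using hr))).differentiableWithinAt
  rw [mem_ball_zero_iff] at hw
  rw [norm_mul, norm_mul, norm_pow, norm_pow, Complex.norm_real, Real.norm_of_nonneg hr0]
  gcongr

/-- The Euler operator `z d/dz` multiplies the `n`-th coefficient of a power series by `n`. -/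
theorem hasSum_euler_powerSeries (hA : ∀ z : ℂ, ‖z‖ < 1 → Summable fun n => A n * z ^ n)
    {z : ℂ} (hz : ‖z‖ < 1) :
    HasSum (fun n : ℕ => n * A n * z ^ n) (z * deriv (fun z => ∑' n, A n * z ^ n) z) := by
  obtain ⟨r, hr, hr1⟩ := exists_between hz
  have hr0 : 0 ≤ r := (norm_nonneg z).trans hr.le
  have hu := (hA r (by simpa [abs_of_nonneg hr0] using hr1)).norm
  have h := Complex.hasSum_deriv_of_summable_norm hu (U := Metric.ball 0 r)
    (F := fun n w => A n * w ^ n) (z := z)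
    (fun n => by fun_prop) Metric.isOpen_ball (fun n w hw => by
      rw [mem_ball_zero_iff] at hw
      rw [norm_mul, norm_mul, norm_pow, norm_pow, Complex.norm_real, Real.norm_of_nonneg hr0]
      gcongr) (by simpa using hr)
  refine (h.mul_left z).of_eq (fun n => ?_) rfl
  rcases n with _ | n
  · simp
  · rw [deriv_const_mul _ (by fun_prop), deriv_pow_field, Nat.add_sub_cancel, pow_succ]
    ring

end PowerSeries

theorem hasSum_zero_add {f : ℕ → ℂ} {s : ℂ} (h : HasSum (fun n => f (n + 1)) (s - f 0)) :
    HasSum f s := by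
  simpa using (hasSum_nat_add_iff 1).1 h

/-! ### Contiguous relations -/

theorem hasSum_olverSum (a b c : ℂ) {z : ℂ} (hz : ‖z‖ < 1) :
    HasSum (fun n : ℕ => olverCoeff a b c n * z ^ n) (olverSum a b c z) :=
  (summable_olver a b c hz).hasSum

theorem hasSum_euler_olverSum (a b c : ℂ) {z : ℂ} (hz : ‖z‖ < 1) :
    HasSum (fun n : ℕ => n * olverCoeff a b c n * z ^ n) (z * deriv (olverSum a b c) z) :=
  hasSum_euler_powerSeries (fun _ => summable_olver a b c) hz

theorem differentiableOn_olverSum (a b c : ℂ) :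
    DifferentiableOn ℂ (olverSum a b c) (Metric.ball 0 1) :=
  differentiableOn_powerSeries fun _ => summable_olver a b c

/-- The operator `z d/dz + c` lowers the third parameter from `c + 1` to `c`. -/
theorem olverSum_lower (a b c : ℂ) {z : ℂ} (hz : ‖z‖ < 1) :
    z * deriv (olverSum a b (c + 1)) z + c * olverSum a b (c + 1) z = olverSum a b c z := by
  refine HasSum.unique (((hasSum_euler_olverSum a b (c + 1) hz).add
    ((hasSum_olverSum a b (c + 1) hz).mul_left c))) ?_
  refine (hasSum_olverSum a b c hz).of_eq (fun n => ?_) rfl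
  rw [← olverCoeff_add_one_right a b c n]
  ring

/-- The relation that raises the third parameter. It is multiplied by `z`, so that only the Euler
operator `z d/dz`, which keeps the powers of `z`, is needed to compare coefficients. -/
theorem olverSum_raise (a b c : ℂ) {z : ℂ} (hz : ‖z‖ < 1) :
    (1 - z) * (z * deriv (olverSum a b c) z) =
      z * ((c - a) * (c - b) * olverSum a b (c + 1) z + (a + b - c) * olverSum a b c z) := by
  have h0 := hasSum_euler_olverSum a b c hz
  have h1 := hasSum_olverSum a b c hz
  have h2 := hasSum_olverSum a b (c + 1) hz
  have h3 : HasSum (fun n : ℕ => n * olverCoeff a b c n * z ^ n)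
      (z * (z * deriv (olverSum a b c) z) + z * ((c - a) * (c - b) * olverSum a b (c + 1) z +
        (a + b - c) * olverSum a b c z)) := by
    refine hasSum_zero_add ?_
    have := (h0.mul_left z).add
      (((h2.mul_left ((c - a) * (c - b))).add (h1.mul_left (a + b - c))).mul_left z)
    refine this.of_eq (fun n => ?_) (by simp)
    have e1 := olverCoeff_succ a b (c + 1) n
    have e2 := olverCoeff_add_one_right a b c n
    have e3 := olverCoeff_add_one_right a b c (n + 1)
    rw [← e2, ← e3]
    push_cast
    linear_combination z ^ (n + 1) * e1
  linear_combination h0.unique h3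

theorem ascPochhammer_eval_succ_left (n : ℕ) (a : ℂ) :
    (ascPochhammer ℂ (n + 1)).eval a = a * (ascPochhammer ℂ n).eval (a + 1) := by
  simp [ascPochhammer_succ_left, Polynomial.eval_comp]

/-- Consecutive coefficients of the series with parameters `(a, 1 - a)` and `(a + 1, -a)` are, after
clearing denominators that may vanish, polynomial multiples of a common factor. -/
theorem exists_olverCoeff_legendre (a c : ℂ) (n : ℕ) : ∃ K : ℂ,
    olverCoeff a (1 - a) c (n + 1) = a * (n + 1 - a) * K ∧
    olverCoeff (a + 1) (-a) c (n + 1) = -a * (n + 1 + a) * K ∧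
    (a + n) * olverCoeff a (1 - a) c n = a * (n + 1) * (c + n) * K ∧
    (n - a) * olverCoeff (a + 1) (-a) c n = -a * (n + 1) * (c + n) * K := by
  have hG := Complex.one_div_Gamma_eq_self_mul_one_div_Gamma_add_one (c + n)
  have hn : (n.factorial : ℂ) ≠ 0 := Nat.cast_ne_zero.2 n.factorial_ne_zero
  have hn1 : (n + 1 : ℂ) ≠ 0 := Nat.cast_add_one_ne_zero n
  have p1 := (ascPochhammer_succ_eval n a).symm.trans (ascPochhammer_eval_succ_left n a)
  have p2 := (ascPochhammer_succ_eval n (-a)).symm.trans (ascPochhammer_eval_succ_left n (-a))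
  rw [neg_add_eq_sub, neg_add_eq_sub] at p2
  refine ⟨(ascPochhammer ℂ n).eval (a + 1) * (ascPochhammer ℂ n).eval (1 - a) *
    (Complex.Gamma (c + n + 1))⁻¹ / (n + 1).factorial, ?_, ?_, ?_, ?_⟩
  · unfold olverCoeff
    rw [ascPochhammer_eval_succ_left n a, ascPochhammer_succ_eval n (1 - a), Nat.cast_succ,
      ← add_assoc]
    ring
  · unfold olverCoeff
    rw [ascPochhammer_eval_succ_left n (-a), ascPochhammer_succ_eval n (a + 1), Nat.cast_succ,
      neg_add_eq_sub, ← add_assoc]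
    ring
  · unfold olverCoeff
    rw [hG, Nat.factorial_succ]
    push_cast
    field_simp
    linear_combination (ascPochhammer ℂ n).eval (1 - a) * (c + n) *
      (Complex.Gamma (c + n + 1))⁻¹ * p1
  · unfold olverCoeff
    rw [hG, Nat.factorial_succ]
    push_cast
    field_simp
    linear_combination (ascPochhammer ℂ n).eval (a + 1) * (c + n) *
      (Complex.Gamma (c + n + 1))⁻¹ * p2

/-- The relation that shifts the parameters from `(a, 1 - a)` to `(a + 1, -a)`. -/
theorem olverSum_legendre_succ (a c : ℂ) {z : ℂ} (hz : ‖z‖ < 1) :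
    2 * (1 - z) * (z * deriv (olverSum a (1 - a) c) z) =
      (a + c - 1) * olverSum (a + 1) (-a) c z
        - (a * (1 - 2 * z) + c - 1) * olverSum a (1 - a) c z := by
  have h0 := hasSum_euler_olverSum a (1 - a) c hz
  have h1 := hasSum_olverSum a (1 - a) c hz
  have h2 := hasSum_olverSum (a + 1) (-a) c hz
  have h3 : HasSum (fun n : ℕ => 2 * (n * olverCoeff a (1 - a) c n * z ^ n) -
      ((a + c - 1) * (olverCoeff (a + 1) (-a) c n * z ^ n) -
        (a + c - 1) * (olverCoeff a (1 - a) c n * z ^ n)))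
      (z * (2 * (z * deriv (olverSum a (1 - a) c) z) + 2 * a * olverSum a (1 - a) c z)) := by
    refine hasSum_zero_add ?_
    have := ((h0.mul_left 2).add (h1.mul_left (2 * a))).mul_left z
    refine this.of_eq (fun n => ?_) (by simp [olverCoeff])
    obtain ⟨K, e1, e2, e3, e4⟩ := exists_olverCoeff_legendre a c n
    rw [e1, e2]
    push_cast
    linear_combination - 2 * z ^ (n + 1) * e3
  linear_combination ((h0.mul_left 2).sub ((h2.mul_left (a + c - 1)).sub
    (h1.mul_left (a + c - 1)))).unique h3

/-- The relation that shifts the parameters from `(a + 1, -a)` back to `(a, 1 - a)`. -/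
theorem olverSum_legendre_pred (a c : ℂ) {z : ℂ} (hz : ‖z‖ < 1) :
    2 * (1 - z) * (z * deriv (olverSum (a + 1) (-a) c) z) =
      (a * (1 - 2 * z) + 1 - c) * olverSum (a + 1) (-a) c z
        - (a + 1 - c) * olverSum a (1 - a) c z := by
  have h0 := hasSum_euler_olverSum (a + 1) (-a) c hz
  have h1 := hasSum_olverSum (a + 1) (-a) c hz
  have h2 := hasSum_olverSum a (1 - a) c hz
  have h3 : HasSum (fun n : ℕ => 2 * (n * olverCoeff (a + 1) (-a) c n * z ^ n) -
      ((a + 1 - c) * (olverCoeff (a + 1) (-a) c n * z ^ n) -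
        (a + 1 - c) * (olverCoeff a (1 - a) c n * z ^ n)))
      (z * (2 * (z * deriv (olverSum (a + 1) (-a) c) z) -
        2 * a * olverSum (a + 1) (-a) c z)) := by
    refine hasSum_zero_add ?_
    have := ((h0.mul_left 2).sub (h1.mul_left (2 * a))).mul_left z
    refine this.of_eq (fun n => ?_) (by simp [olverCoeff])
    obtain ⟨K, e1, e2, e3, e4⟩ := exists_olverCoeff_legendre a c n
    rw [e1, e2]
    push_cast
    linear_combination - 2 * z ^ (n + 1) * e4
  linear_combination ((h0.mul_left 2).sub ((h1.mul_left (a + 1 - c)).sub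
    (h2.mul_left (a + 1 - c)))).unique h3

/-! ### The cut plane -/

theorem mem_cutPlane_iff {z : ℂ} : z ∈ cutPlane ↔ 1 - z ∈ Complex.slitPlane := by
  rw [← not_iff_not, Complex.mem_slitPlane_iff, cutPlane, Set.notMem_compl_iff]
  push Not
  constructor
  · rintro ⟨t, ht, rfl⟩
    have : (1 : ℝ) ≤ t := ht
    simpa using this
  · rintro ⟨h1, h2⟩
    refine ⟨z.re, ?_, ?_⟩
    · simpa using h1
    · apply Complex.ext <;> simp_all

theorem ball_subset_cutPlane : Metric.ball (0 : ℂ) 1 ⊆ cutPlane := by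
  rintro z hz ⟨t, ht, rfl⟩
  have : (1 : ℝ) ≤ t := ht
  rw [mem_ball_zero_iff, Complex.norm_real, Real.norm_eq_abs] at hz
  linarith [le_abs_self t]

theorem isPreconnected_cutPlane : IsPreconnected cutPlane :=
  (starConvex_cutPlane.isPathConnected zero_mem_cutPlane).isConnected.isPreconnected

/-- Identity theorem: analytic functions on the cut plane that agree on the unit disk are equal. -/
theorem eqOn_cutPlane {f g : ℂ → ℂ} (hf : DifferentiableOn ℂ f cutPlane)
    (hg : DifferentiableOn ℂ g cutPlane) (h : ∀ z : ℂ, ‖z‖ < 1 → f z = g z) :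
    Set.EqOn f g cutPlane := by
  refine (hf.analyticOnNhd isOpen_cutPlane).eqOn_of_preconnected_of_eventuallyEq
    (hg.analyticOnNhd isOpen_cutPlane) isPreconnected_cutPlane zero_mem_cutPlane ?_
  filter_upwards [Metric.ball_mem_nhds (0 : ℂ) one_pos] with z hz
  exact h z (mem_ball_zero_iff.1 hz)

theorem one_sub_mul_mem_slitPlane {z : ℂ} (hz : z ∈ cutPlane) {t : ℝ} (ht : t ∈ Set.Icc (0 : ℝ) 1) :
    1 - z * t ∈ Complex.slitPlane := by
  rw [← mem_cutPlane_iff, mul_comm, ← Complex.real_smul]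
  exact starConvex_zero_iff.1 starConvex_cutPlane hz ht.1 ht.2

/-! ### Euler's integral -/

theorem hasSum_one_sub_cpow (a : ℂ) {z : ℂ} (hz : ‖z‖ < 1) :
    HasSum (fun n : ℕ => (ascPochhammer ℂ n).eval a / n.factorial * z ^ n) ((1 - z) ^ (-a)) := by
  have h := (Complex.one_div_one_sub_cpow_hasFPowerSeriesOnBall_zero a).hasSum
    (y := z) (by simpa [Metric.mem_eball, edist_zero_right, enorm_eq_nnnorm, ← NNReal.coe_lt_one] using hz)
  refine h.of_eq (fun n => ?_) ?_
  · rw [FormalMultilinearSeries.ofScalars_apply_eq, smul_eq_mul]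
    congr 1
    rw [Ring.choose, div_eq_iff (Nat.cast_ne_zero.2 n.factorial_ne_zero), mul_comm,
      ← nsmul_eq_mul, Ring.factorial_nsmul_multichoose_eq_ascPochhammer,
      Polynomial.ascPochhammer_smeval_eq_eval]
    congr 1; ring
  · simp [Complex.cpow_neg]

theorem ne_neg_natCast_of_re_pos {b : ℂ} (hb : 0 < b.re) (n : ℕ) : b ≠ -n := fun h => by
  have := congrArg Complex.re h
  simp only [Complex.neg_re, Complex.natCast_re] at this
  linarith [(Nat.cast_nonneg n : (0 : ℝ) ≤ n)]

/-- Euler's integral for the hypergeometric function, up to a factor `Γ(b) Γ(c - b)`. -/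
noncomputable def eulerIntegral (a b c z : ℂ) : ℂ :=
  ∫ t : ℝ in 0..1, (t : ℂ) ^ (b - 1) * (1 - t : ℂ) ^ (c - b - 1) * (1 - z * t) ^ (-a)

theorem intervalIntegrable_euler (a : ℂ) {b c z : ℂ} (hb : 0 < b.re) (hc : b.re < c.re)
    (hz : z ∈ cutPlane) : IntervalIntegrable (fun t : ℝ =>
      (t : ℂ) ^ (b - 1) * (1 - t : ℂ) ^ (c - b - 1) * (1 - z * t) ^ (-a)) volume 0 1 := by
  refine (Complex.betaIntegral_convergent hb (v := c - b) (by simpa using hc)).mul_continuousOn ?_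
  rw [uIcc_of_le zero_le_one]
  exact ContinuousOn.cpow_const (by fun_prop) fun t ht => one_sub_mul_mem_slitPlane hz ht

theorem differentiableOn_eulerIntegral (a : ℂ) {b c : ℂ} (hb : 0 < b.re) (hc : b.re < c.re) :
    DifferentiableOn ℂ (eulerIntegral a b c) cutPlane := by
  intro z hz
  obtain ⟨ε, hε, hεz⟩ := Metric.nhds_basis_closedBall.mem_iff.1 (isOpen_cutPlane.mem_nhds hz)
  have hK : IsCompact (Metric.closedBall z ε ×ˢ Icc (0 : ℝ) 1) :=
    (isCompact_closedBall z ε).prod isCompact_Icc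
  obtain ⟨C, hC⟩ := hK.exists_bound_of_continuousOn
    (f := fun p : ℂ × ℝ => -a * (1 - p.1 * p.2) ^ (-a - 1) * (-p.2 : ℂ)) (by
      refine ContinuousOn.mul (ContinuousOn.mul continuousOn_const
        (ContinuousOn.cpow_const (by fun_prop) fun p hp => ?_)) (by fun_prop)
      exact one_sub_mul_mem_slitPlane (hεz hp.1) hp.2)
  have hbeta := Complex.betaIntegral_convergent hb (v := c - b) (by simpa using hc)
  have hI : Ι (0 : ℝ) 1 ⊆ Icc 0 1 := by
    rw [uIoc_of_le zero_le_one]; exact Ioc_subset_Icc_self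
  have hmeas : AEStronglyMeasurable (fun t : ℝ => (t : ℂ) ^ (b - 1) * (1 - t : ℂ) ^ (c - b - 1))
      (volume.restrict (Ι 0 1)) := hbeta.def'.aestronglyMeasurable
  refine (intervalIntegral.hasDerivAt_integral_of_dominated_loc_of_deriv_le (𝕜 := ℂ)
    (F := fun z (t : ℝ) => (t : ℂ) ^ (b - 1) * (1 - t : ℂ) ^ (c - b - 1) * (1 - z * t) ^ (-a))
    (F' := fun z (t : ℝ) => (t : ℂ) ^ (b - 1) * (1 - t : ℂ) ^ (c - b - 1) *
      (-a * (1 - z * t) ^ (-a - 1) * (-t : ℂ)))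
    (bound := fun t : ℝ => ‖(t : ℂ) ^ (b - 1) * (1 - t : ℂ) ^ (c - b - 1)‖ * C)
    (x₀ := z) (s := Metric.closedBall z ε) (Metric.closedBall_mem_nhds z hε) ?_
    (intervalIntegrable_euler a hb hc hz) ?_ ?_ (hbeta.norm.mul_const C)
    ?_).2.differentiableAt.differentiableWithinAt
  · filter_upwards [isOpen_cutPlane.mem_nhds hz] with w hw
    exact (intervalIntegrable_euler a hb hc hw).def'.aestronglyMeasurable
  · refine hmeas.mul (ContinuousOn.aestronglyMeasurable ?_ measurableSet_uIoc)
    refine ContinuousOn.mul (ContinuousOn.mul continuousOn_const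
      (ContinuousOn.cpow_const (by fun_prop) fun t ht => ?_)) (by fun_prop)
    exact one_sub_mul_mem_slitPlane hz (hI ht)
  · refine Filter.Eventually.of_forall fun t ht w hw => ?_
    rw [norm_mul]
    gcongr
    exact hC (w, t) ⟨hw, hI ht⟩
  · refine Filter.Eventually.of_forall fun t ht w hw => ?_
    refine HasDerivAt.const_mul _ ?_
    have h1 : HasDerivAt (fun w : ℂ => 1 - w * t) (-t : ℂ) w := by
      simpa using ((hasDerivAt_id w).mul_const (t : ℂ)).const_sub 1
    exact h1.cpow_const (one_sub_mul_mem_slitPlane (hεz hw) (hI ht))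

/-- Expanding the binomial factor of Euler's integral gives the hypergeometric series. -/
theorem eulerIntegral_eq (a : ℂ) {b c z : ℂ} (hb : 0 < b.re) (hc : b.re < c.re) (hz : ‖z‖ < 1) :
    eulerIntegral a b c z = Complex.Gamma b * Complex.Gamma (c - b) * olverSum a b c z := by
  have hcb : 0 < (c - b).re := by simpa using hc
  have hbeta := Complex.betaIntegral_convergent hb hcb
  have hbin := (hasSum_one_sub_cpow a (z := (‖z‖ : ℂ)) (by simpa using hz)).summable.norm
  have h : HasSum (fun n : ℕ => ∫ t : ℝ in 0..1, (t : ℂ) ^ (b - 1) * (1 - t : ℂ) ^ (c - b - 1) *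
      ((ascPochhammer ℂ n).eval a / n.factorial * (z * t) ^ n)) (eulerIntegral a b c z) := by
    refine intervalIntegral.hasSum_integral_of_dominated_convergence
      (fun n t => ‖(t : ℂ) ^ (b - 1) * (1 - t : ℂ) ^ (c - b - 1)‖ *
        ‖(ascPochhammer ℂ n).eval a / n.factorial * (‖z‖ : ℂ) ^ n‖) (fun n => ?_) (fun n => ?_)
      ?_ ?_ ?_
    · exact hbeta.def'.aestronglyMeasurable.mul (Continuous.aestronglyMeasurable (by fun_prop))
    · refine Filter.Eventually.of_forall fun t ht => ?_
      rw [uIoc_of_le zero_le_one] at ht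
      rw [norm_mul _ (_ * _ : ℂ), norm_mul (_ / _ : ℂ), norm_mul (_ / _ : ℂ)]
      gcongr
      rw [norm_pow, norm_pow, norm_mul, Complex.norm_real, Complex.norm_real, norm_norm,
        Real.norm_of_nonneg ht.1.le]
      have := ht.1.le
      gcongr
      exact mul_le_of_le_one_right (norm_nonneg z) ht.2
    · exact Filter.Eventually.of_forall fun t _ => hbin.mul_left _
    · simp_rw [tsum_mul_left]
      exact hbeta.norm.mul_const _
    · refine Filter.Eventually.of_forall fun t ht => (hasSum_one_sub_cpow a ?_).mul_left _
      rw [uIoc_of_le zero_le_one] at ht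
      rw [norm_mul, Complex.norm_real, Real.norm_of_nonneg ht.1.le]
      exact (mul_le_of_le_one_right (norm_nonneg z) ht.2).trans_lt hz
  refine h.unique (((hasSum_olverSum a b c hz).mul_left _).of_eq (fun n => ?_) rfl)
  have h1 : ∫ t : ℝ in 0..1, (t : ℂ) ^ (b - 1) * (1 - t : ℂ) ^ (c - b - 1) *
      ((ascPochhammer ℂ n).eval a / n.factorial * (z * t) ^ n) =
      (ascPochhammer ℂ n).eval a / n.factorial * z ^ n * Complex.betaIntegral (b + n) (c - b) := by
    rw [Complex.betaIntegral, ← intervalIntegral.integral_const_mul]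
    refine intervalIntegral.integral_congr_ae (Filter.Eventually.of_forall fun t ht => ?_)
    rw [uIoc_of_le zero_le_one] at ht
    have ht0 : (t : ℂ) ≠ 0 := Complex.ofReal_ne_zero.2 ht.1.ne'
    rw [show b + n - 1 = b - 1 + n by ring, Complex.cpow_add _ _ ht0, Complex.cpow_natCast]
    ring
  have hbn : 0 < (b + n).re := by
    simp only [Complex.add_re, Complex.natCast_re]
    linarith [(Nat.cast_nonneg n : (0 : ℝ) ≤ n)]
  rw [h1, Complex.betaIntegral_eq_Gamma_mul_div _ _ hbn hcb, show b + n + (c - b) = c + n by ring, olverCoeff,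
    ← Complex.Gamma_add_nat_div_Gamma_eq b (ne_neg_natCast_of_re_pos hb)]
  have := Complex.Gamma_ne_zero_of_re_pos hb
  field_simp

/-! ### Continuation to the cut plane -/

/-- Euler's integral provides the continuation if `Re c > Re b`; the other values of `c` are
reached by the differential operator that lowers `c` by one. -/
theorem exists_continuation_of_re_pos (a : ℂ) {b : ℂ} (hb : 0 < b.re) (c : ℂ) :
    ∃ g : ℂ → ℂ, DifferentiableOn ℂ g cutPlane ∧ EqOn g (olverSum a b c) (Metric.ball 0 1) := by
  obtain ⟨N, hN⟩ := exists_nat_gt (b.re - c.re)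
  induction N generalizing c with
  | zero =>
    have hc : b.re < c.re := by simpa using hN
    have hcb : 0 < (c - b).re := by simpa using hc
    refine ⟨fun z => (Complex.Gamma b * Complex.Gamma (c - b))⁻¹ * eulerIntegral a b c z,
      (differentiableOn_eulerIntegral a hb hc).const_mul _, fun z hz => ?_⟩
    simp only
    rw [eulerIntegral_eq a hb hc (mem_ball_zero_iff.1 hz), inv_mul_cancel_left₀]
    exact mul_ne_zero (Complex.Gamma_ne_zero_of_re_pos hb) (Complex.Gamma_ne_zero_of_re_pos hcb)
  | succ N ih =>
    obtain ⟨g, hg, hgs⟩ := ih (c + 1) (by push_cast at hN; simp; linarith)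
    refine ⟨fun z => z * deriv g z + c * g z,
      (differentiableOn_id.mul (hg.deriv isOpen_cutPlane)).add (hg.const_mul c), fun z hz => ?_⟩
    have hd : deriv g z = deriv (olverSum a b (c + 1)) z :=
      (hgs.eventuallyEq_of_mem (Metric.isOpen_ball.mem_nhds hz)).deriv_eq
    simp only
    rw [hd, hgs hz, olverSum_lower a b c (mem_ball_zero_iff.1 hz)]

theorem exists_continuation_legendre (a c : ℂ) : ∃ g : ℂ → ℂ,
    DifferentiableOn ℂ g cutPlane ∧ EqOn g (olverSum a (1 - a) c) (Metric.ball 0 1) := by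
  rcases lt_or_ge 0 a.re with ha | ha
  · obtain ⟨g, hg, h⟩ := exists_continuation_of_re_pos (1 - a) ha c
    exact ⟨g, hg, fun z hz => (h hz).trans (olverSum_comm _ _ _ _)⟩
  · exact exists_continuation_of_re_pos a (by simp; linarith) c

/-! ### The value at one half -/

/-- The substitution `x = s ^ 2` in the beta integral. -/
theorem integral_cpow_mul_one_sub_sq_cpow (p q : ℂ) :
    ∫ s : ℝ in 0..1, (s : ℂ) ^ (2 * p - 1) * (1 - (s : ℂ) ^ 2) ^ (q - 1) =
      Complex.betaIntegral p q / 2 := by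
  have himg : (fun s : ℝ => s ^ 2) '' Ioo 0 1 = Ioo 0 1 := by
    ext x
    constructor
    · rintro ⟨s, hs, rfl⟩
      exact ⟨by have := hs.1; positivity, by nlinarith [hs.1, hs.2]⟩
    · intro hx
      exact ⟨√x, ⟨Real.sqrt_pos.2 hx.1, by rw [Real.sqrt_lt' one_pos]; simpa using hx.2⟩,
        Real.sq_sqrt hx.1.le⟩
  have h := integral_image_eq_integral_abs_deriv_smul (s := Ioo (0 : ℝ) 1) (f := fun s => s ^ 2)
    (f' := fun s => 2 * s) measurableSet_Ioo
    (fun s _ => by simpa using (hasDerivAt_pow 2 s).hasDerivWithinAt)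
    (fun s hs t ht hst => (pow_left_inj₀ hs.1.le ht.1.le two_ne_zero).1 hst)
    (fun x : ℝ => (x : ℂ) ^ (p - 1) * (1 - (x : ℂ)) ^ (q - 1))
  rw [himg] at h
  rw [Complex.betaIntegral, intervalIntegral.integral_of_le zero_le_one,
    intervalIntegral.integral_of_le zero_le_one, integral_Ioc_eq_integral_Ioo,
    integral_Ioc_eq_integral_Ioo, h, eq_div_iff two_ne_zero, mul_comm, ← integral_const_mul]
  refine setIntegral_congr_fun measurableSet_Ioo fun s hs => ?_
  have hs0 : (s : ℂ) ≠ 0 := Complex.ofReal_ne_zero.2 hs.1.ne'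
  have e : ((s ^ 2 : ℝ) : ℂ) ^ (p - 1) * s = (s : ℂ) ^ (2 * p - 1) := by
    rw [pow_two, Complex.ofReal_mul, Complex.mul_cpow_ofReal_nonneg hs.1.le hs.1.le,
      ← Complex.cpow_add _ _ hs0]
    nth_rewrite 2 [← Complex.cpow_one (s : ℂ)]
    rw [← Complex.cpow_add _ _ hs0]
    ring_nf
  rw [abs_of_nonneg (by linarith [hs.1]), Complex.real_smul, ← e]
  push_cast
  ring

theorem olverSum_one_half_of_re_lt {a c : ℂ} (ha : 0 < a.re) (hc : a.re < c.re) :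
    olverSum a (1 - a) c (1 / 2) = 2 ^ (1 - c) * (√Real.pi : ℂ) *
      ((Complex.Gamma ((c + a) / 2))⁻¹ * (Complex.Gamma ((c + 1 - a) / 2))⁻¹) := by
  have hca : 0 < (c - a).re := by simpa using hc
  have hca2 : 0 < ((c - a) / 2).re := by simpa using hc
  have hE := eulerIntegral_eq (1 - a) (z := 1 / 2) ha hc (by norm_num)
  have hI : eulerIntegral (1 - a) a c (1 / 2) =
      2 ^ (1 - a) * (Complex.betaIntegral ((c - a) / 2) a / 2) := by
    rw [← integral_cpow_mul_one_sub_sq_cpow, ← intervalIntegral.integral_const_mul,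
      eulerIntegral]
    have := intervalIntegral.integral_comp_sub_left (a := 0) (b := 1) (fun t : ℝ =>
      (t : ℂ) ^ (a - 1) * (1 - t : ℂ) ^ (c - a - 1) * (1 - 1 / 2 * t) ^ (-(1 - a))) 1
    simp only [sub_self, sub_zero] at this
    rw [← this]
    refine intervalIntegral.integral_congr fun s hs => ?_
    rw [uIcc_of_le zero_le_one] at hs
    have h1 : (1 - ((1 - s : ℝ) : ℂ)) = s := by push_cast; ring
    have h2 : (1 - 1 / 2 * ((1 - s : ℝ) : ℂ)) = ((1 / 2 : ℝ) : ℂ) * ((1 + s : ℝ) : ℂ) := by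
      push_cast; ring
    have h3 : (1 - (s : ℂ) ^ 2) = ((1 - s : ℝ) : ℂ) * ((1 + s : ℝ) : ℂ) := by push_cast; ring
    have h5 : 0 ≤ 1 + s := by linarith [hs.1]
    have h4 : (((1 / 2 : ℝ) : ℂ)) ^ (a - 1) = 2 ^ (1 - a) := by
      rw [← neg_sub 1 a, Complex.cpow_neg, ← Complex.inv_cpow _ _ (by
        rw [Complex.arg_ofReal_of_nonneg (by norm_num)]; exact Real.pi_ne_zero.symm)]
      norm_num
    rw [h1, h2, h3, Complex.mul_cpow_ofReal_nonneg (sub_nonneg.2 hs.2) h5,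
      neg_sub, Complex.mul_cpow_ofReal_nonneg (by norm_num) h5, h4]
    ring_nf
  rw [hI, Complex.betaIntegral_eq_Gamma_mul_div _ _ hca2 ha, olverSum_comm,
    show (c - a) / 2 + a = (c + a) / 2 by ring] at hE
  have hD := Complex.Gamma_mul_Gamma_add_half ((c - a) / 2)
  rw [show (c - a) / 2 + 1 / 2 = (c + 1 - a) / 2 by ring, mul_div_cancel₀ _ two_ne_zero] at hD
  have g1 := Complex.Gamma_ne_zero_of_re_pos ha
  have g2 := Complex.Gamma_ne_zero_of_re_pos hca
  have g3 := Complex.Gamma_ne_zero_of_re_pos hca2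
  have g4 : Complex.Gamma ((c + 1 - a) / 2) ≠ 0 :=
    Complex.Gamma_ne_zero_of_re_pos (by simp; linarith)
  have g5 : Complex.Gamma ((c + a) / 2) ≠ 0 :=
    Complex.Gamma_ne_zero_of_re_pos (by simp; linarith)
  have p1 : (2 : ℂ) ^ (1 - (c - a)) * 2 ^ (1 - a) = 2 * 2 ^ (1 - c) := by
    rw [← Complex.cpow_add _ _ two_ne_zero,
      show 1 - (c - a) + (1 - a) = 1 + (1 - c) by ring, Complex.cpow_add _ _ two_ne_zero,
      Complex.cpow_one]
  field_simp at hE ⊢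
  refine mul_left_cancel₀ (mul_ne_zero two_ne_zero g2) ?_
  linear_combination -Complex.Gamma ((c + 1 - a) / 2) * hE + 2 ^ (1 - a) * hD +
    Complex.Gamma (c - a) * (√Real.pi : ℂ) * p1

/-- At `z = 1 / 2` the contiguous relation between `c`, `c + 1` and `c + 2` has only two terms. -/
theorem olverSum_one_half_add_two (a c : ℂ) : olverSum a (1 - a) c (1 / 2) =
    (c + a) * (c + 1 - a) * olverSum a (1 - a) (c + 2) (1 / 2) := by
  have hz : ‖(1 / 2 : ℂ)‖ < 1 := by norm_num
  have h1 := olverSum_lower a (1 - a) c hz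
  have h2 := olverSum_raise a (1 - a) (c + 1) hz
  rw [show c + 1 + 1 = c + 2 by ring] at h2
  linear_combination -h1 + 2 * h2

/-- **Bailey's theorem**: the value at `1 / 2` of a Legendre-type series. -/
theorem olverSum_one_half (a c : ℂ) :
    olverSum a (1 - a) c (1 / 2) = 2 ^ (1 - c) * (√Real.pi : ℂ) *
      ((Complex.Gamma ((c + a) / 2))⁻¹ * (Complex.Gamma ((c + 1 - a) / 2))⁻¹) := by
  wlog ha : 0 < a.re generalizing a
  · have := this (1 - a) (by simp; linarith)
    rw [sub_sub_cancel, olverSum_comm] at this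
    rw [this]
    ring_nf
  obtain ⟨N, hN⟩ := exists_nat_gt (a.re - c.re)
  induction N generalizing c with
  | zero => exact olverSum_one_half_of_re_lt ha (by simpa using hN)
  | succ N ih =>
    have h1 := Complex.one_div_Gamma_eq_self_mul_one_div_Gamma_add_one ((c + a) / 2)
    have h2 := Complex.one_div_Gamma_eq_self_mul_one_div_Gamma_add_one ((c + 1 - a) / 2)
    rw [olverSum_one_half_add_two, ih (c + 2) (by push_cast at hN; simp; linarith), h1, h2,
      show (c + a) / 2 + 1 = (c + 2 + a) / 2 by ring,
      show (c + 1 - a) / 2 + 1 = (c + 2 + 1 - a) / 2 by ring,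
      show 1 - (c + 2) = 1 - c - 2 by ring, Complex.cpow_sub _ _ two_ne_zero,
      show (2 : ℂ) ^ (2 : ℂ) = 4 by rw [Complex.cpow_ofNat]; norm_num]
    ring

/-! ### Pfaff's transformation -/

/-- The **Chu–Vandermonde identity**, divided by a Gamma function so that it holds for all `c`. -/
theorem chu_vandermonde (c d : ℂ) (m : ℕ) :
    ∑ p ∈ Finset.HasAntidiagonal.antidiagonal m, (m.choose p.1 : ℂ) *
      ((-1) ^ p.1 * (ascPochhammer ℂ p.1).eval d * (Complex.Gamma (c + p.1))⁻¹) =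
    (ascPochhammer ℂ m).eval (c - d) * (Complex.Gamma (c + m))⁻¹ := by
  induction m generalizing c d with
  | zero => simp
  | succ m ih =>
    have h1 := Finset.sum_antidiagonal_choose_succ_mul (R := ℂ)
      (fun i _ => (-1) ^ i * (ascPochhammer ℂ i).eval d * (Complex.Gamma (c + i))⁻¹) m
    have h2 : ∑ p ∈ Finset.HasAntidiagonal.antidiagonal m, (m.choose p.2 : ℂ) * ((-1) ^ (p.1 + 1) *
          (ascPochhammer ℂ (p.1 + 1)).eval d * (Complex.Gamma (c + (p.1 + 1 : ℕ)))⁻¹) =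
        -d * ∑ p ∈ Finset.HasAntidiagonal.antidiagonal m, (m.choose p.1 : ℂ) * ((-1) ^ p.1 *
          (ascPochhammer ℂ p.1).eval (d + 1) * (Complex.Gamma (c + 1 + p.1))⁻¹) := by
      rw [Finset.mul_sum]
      refine Finset.sum_congr rfl fun p hp => ?_
      rw [Finset.HasAntidiagonal.mem_antidiagonal] at hp
      rw [← Nat.choose_symm_of_eq_add hp.symm, ascPochhammer_eval_succ_left, Nat.cast_succ,
        add_comm (p.1 : ℂ) 1, ← add_assoc]
      ring
    rw [h1, h2, ih, ih, ascPochhammer_succ_eval, add_sub_add_right_eq_sub,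
      Complex.one_div_Gamma_eq_self_mul_one_div_Gamma_add_one (c + m), Nat.cast_succ,
      add_right_comm c 1 (m : ℂ), ← add_assoc]
    ring

theorem ascPochhammer_eval_add (a : ℂ) (i j : ℕ) :
    (ascPochhammer ℂ (i + j)).eval a =
      (ascPochhammer ℂ i).eval a * (ascPochhammer ℂ j).eval (a + i) := by
  rw [← ascPochhammer_mul, Polynomial.eval_mul, Polynomial.eval_comp]
  simp

/-- Near the origin Pfaff's transformation follows by expanding both sides into a double series;
`1 / 3` is small enough for absolute convergence. -/
theorem pfaff_of_norm_lt (a b c : ℂ) {z : ℂ} (hz : ‖z‖ < 1 / 3) :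
    (1 - z) ^ (-a) * olverSum a (c - b) c (z / (z - 1)) = olverSum a b c z := by
  -- `e i` is the `i`-th coefficient of the series with parameters `1`, `c - b`, `c`, so that
  -- convergence at `1 / 2` bounds it by a multiple of `2 ^ i`
  set e : ℕ → ℂ := fun i =>
    (ascPochhammer ℂ i).eval (c - b) * (Complex.Gamma (c + i))⁻¹ with he
  obtain ⟨K, hK⟩ : ∃ K : ℝ, ∀ i, ‖e i‖ ≤ K * 2 ^ i := by
    have hs := (summable_olver 1 (c - b) c (z := 1 / 2) (by norm_num)).norm
    obtain ⟨K, hK⟩ := hs.tendsto_atTop_zero.bddAbove_range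
    refine ⟨K, fun i => ?_⟩
    have := hK ⟨i, rfl⟩
    simp only [olverCoeff, ascPochhammer_eval_one] at this
    have hi : (i.factorial : ℂ) ≠ 0 := Nat.cast_ne_zero.2 i.factorial_ne_zero
    rw [mul_assoc, mul_div_cancel_left₀ _ hi, norm_mul] at this
    rw [← div_le_iff₀ (by positivity)]
    simpa [div_eq_mul_inv, he] using this
  set F : ℕ × ℕ → ℂ := fun p =>
    olverCoeff a (c - b) c p.1 * (-z) ^ p.1 *
      ((ascPochhammer ℂ p.2).eval (a + p.1) / p.2.factorial * z ^ p.2) with hF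
  have hFm : ∀ m : ℕ, ∀ p ∈ Finset.HasAntidiagonal.antidiagonal m, F p =
      (ascPochhammer ℂ m).eval a / m.factorial * z ^ m *
        ((m.choose p.1 : ℂ) * ((-1) ^ p.1 * e p.1)) := by
    intro m p hp
    rw [Finset.HasAntidiagonal.mem_antidiagonal] at hp
    subst hp
    simp only [hF, he]
    rw [ascPochhammer_eval_add, Nat.cast_add_choose, olverCoeff, neg_pow, pow_add]
    have h1 : (p.1.factorial : ℂ) ≠ 0 := Nat.cast_ne_zero.2 p.1.factorial_ne_zero
    have h2 : (p.2.factorial : ℂ) ≠ 0 := Nat.cast_ne_zero.2 p.2.factorial_ne_zero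
    have h3 : ((p.1 + p.2).factorial : ℂ) ≠ 0 := Nat.cast_ne_zero.2 (Nat.factorial_ne_zero _)
    field_simp
  -- the bound `2 ^ i` turns the binomial sum over the `m`-th diagonal into `3 ^ m`
  have hbin : Summable fun m : ℕ =>
      ‖(ascPochhammer ℂ m).eval a / m.factorial * (3 * ‖z‖ : ℂ) ^ m‖ :=
    (hasSum_one_sub_cpow a (z := 3 * ‖z‖) (by simp; linarith)).summable.norm
  have hsumm : Summable F := by
    rw [← Finset.HasAntidiagonal.sigmaAntidiagonalEquivProd.summable_iff]
    refine Summable.of_norm ((summable_sigma_of_nonneg fun _ => norm_nonneg _).2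
      ⟨fun m => Summable.of_finite, ?_⟩)
    refine Summable.of_nonneg_of_le (fun m => tsum_nonneg fun _ => norm_nonneg _)
      (fun m => ?_) (hbin.mul_left K)
    rw [tsum_fintype]
    refine (Finset.sum_coe_sort (Finset.HasAntidiagonal.antidiagonal m)
      (fun p => ‖F p‖)).trans_le ?_
    have h3 : ∑ p ∈ Finset.HasAntidiagonal.antidiagonal m, (m.choose p.1 : ℝ) * 2 ^ p.1 =
        3 ^ m := by
      have := (Commute.all (2 : ℝ) 1).add_pow' m
      simp only [one_pow, mul_one, nsmul_eq_mul] at this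
      rw [← this]; norm_num
    calc ∑ p ∈ Finset.HasAntidiagonal.antidiagonal m, ‖F p‖
        ≤ ∑ p ∈ Finset.HasAntidiagonal.antidiagonal m,
          ‖(ascPochhammer ℂ m).eval a / m.factorial * z ^ m‖ *
            ((m.choose p.1 : ℝ) * (K * 2 ^ p.1)) := by
          refine Finset.sum_le_sum fun p hp => ?_
          rw [hFm m p hp, norm_mul, norm_mul (m.choose p.1 : ℂ), Complex.norm_natCast,
            norm_mul _ (e p.1), norm_pow, norm_neg, norm_one, one_pow, one_mul]
          gcongr
          exact hK _
      _ = K * ‖(ascPochhammer ℂ m).eval a / m.factorial * (3 * ‖z‖ : ℂ) ^ m‖ := by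
          rw [← Finset.mul_sum]
          simp_rw [mul_left_comm _ K]
          rw [← Finset.mul_sum, h3, norm_mul, norm_mul (_ / _ : ℂ), norm_pow, norm_pow, norm_mul,
            Complex.norm_real, norm_norm, mul_pow]
          norm_num
          ring
  have hdiag : HasSum (fun m => olverCoeff a b c m * z ^ m) (∑' p, F p) := by
    have h := (Finset.HasAntidiagonal.sigmaAntidiagonalEquivProd.hasSum_iff.2 hsumm.hasSum).sigma
      (g := fun m => ∑ p ∈ Finset.HasAntidiagonal.antidiagonal m, F p) (fun m => Finset.hasSum _ F)
    refine h.of_eq (fun m => ?_) rfl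
    rw [Finset.sum_congr rfl (hFm m), ← Finset.mul_sum]
    have := chu_vandermonde c (c - b) m
    simp only [mul_assoc] at this
    simp only [he]
    rw [this, sub_sub_cancel, olverCoeff]
    ring
  have hz1 : ‖z‖ < 1 := by linarith
  have h1z : 1 - z ≠ 0 := sub_ne_zero.2 fun h => by rw [← h] at hz1; simp at hz1
  have hw : ‖z / (z - 1)‖ < 1 := by
    have : 1 - ‖z‖ ≤ ‖z - 1‖ := by
      rw [norm_sub_rev]; simpa using norm_sub_norm_le (1 : ℂ) z
    rw [norm_div, div_lt_one (by linarith)]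
    linarith
  have hrow := hsumm.hasSum.prod_fiberwise fun i =>
    (hasSum_one_sub_cpow (a + i) hz1).mul_left (olverCoeff a (c - b) c i * (-z) ^ i)
  have := ((hasSum_olverSum a (c - b) c hw).mul_left ((1 - z) ^ (-a))).unique
    (hrow.of_eq (fun i => ?_) rfl)
  · rw [this]
    exact (hdiag.unique (hasSum_olverSum a b c hz1))
  · rw [neg_add, Complex.cpow_add _ _ h1z, Complex.cpow_neg _ (i : ℂ), Complex.cpow_natCast,
      ← neg_sub 1 z, div_neg, ← neg_div, div_pow]
    field_simp

/-! ### The regularized hypergeometric function on the cut plane -/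

theorem regularizedF_eqOn {a b c : ℂ} {g : ℂ → ℂ} (hg : DifferentiableOn ℂ g cutPlane)
    (h : EqOn g (olverSum a b c) (Metric.ball 0 1)) : EqOn (regularizedF a b c) g cutPlane :=
  cutContinuation_eq hg h

theorem eqOn_regularizedF_olverSum {a b c : ℂ}
    (h : ∃ g : ℂ → ℂ, DifferentiableOn ℂ g cutPlane ∧ EqOn g (olverSum a b c) (Metric.ball 0 1)) :
    DifferentiableOn ℂ (regularizedF a b c) cutPlane ∧
      EqOn (regularizedF a b c) (olverSum a b c) (Metric.ball 0 1) := by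
  obtain ⟨g, hg, hgs⟩ := h
  have := regularizedF_eqOn hg hgs
  exact ⟨hg.congr this, (this.mono ball_subset_cutPlane).trans hgs⟩

theorem gaussF_eq_Gamma_mul_regularizedF {a b c : ℂ}
    (h : ∃ g : ℂ → ℂ, DifferentiableOn ℂ g cutPlane ∧ EqOn g (olverSum a b c) (Metric.ball 0 1))
    (hc : ∀ n : ℕ, c ≠ -n) {z : ℂ} (hz : z ∈ cutPlane) :
    gaussF a b c z = Complex.Gamma c * regularizedF a b c z := by
  obtain ⟨hd, hs⟩ := eqOn_regularizedF_olverSum h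
  refine cutContinuation_eq (g := fun z => Complex.Gamma c * regularizedF a b c z)
    (hd.const_mul _) (fun w hw => ?_) hz
  simp only
  rw [hs hw, olverSum, ordinaryHypergeometric_eq_tsum, ← tsum_mul_left]
  refine tsum_congr fun n => ?_
  have hG : Complex.Gamma c ≠ 0 := Complex.Gamma_ne_zero hc
  rw [← Complex.Gamma_add_nat_div_Gamma_eq c hc, olverCoeff, smul_eq_mul]
  field_simp

theorem exists_continuation_of_add_eq_one {a b : ℂ} (hab : a + b = 1) (c : ℂ)
    :
    ∃ g : ℂ → ℂ, DifferentiableOn ℂ g cutPlane ∧ EqOn g (olverSum a b c) (Metric.ball 0 1) := by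
  obtain rfl : b = 1 - a := by rw [← hab]; ring
  exact exists_continuation_legendre a c

theorem differentiableOn_regularizedF {a b : ℂ} (hab : a + b = 1) (c : ℂ)
    : DifferentiableOn ℂ (regularizedF a b c) cutPlane :=
  (eqOn_regularizedF_olverSum (exists_continuation_of_add_eq_one hab c)).1

theorem hasDerivAt_regularizedF {a b : ℂ} (hab : a + b = 1) (c : ℂ)
    {z : ℂ} (hz : z ∈ cutPlane) :
    HasDerivAt (regularizedF a b c) (deriv (regularizedF a b c) z) z :=
  ((differentiableOn_regularizedF hab c).differentiableAt
    (isOpen_cutPlane.mem_nhds hz)).hasDerivAt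

theorem regularizedF_eq_olverSum {a b : ℂ} (hab : a + b = 1) (c : ℂ)
    {z : ℂ} (hz : ‖z‖ < 1) :
    regularizedF a b c z = olverSum a b c z :=
  (eqOn_regularizedF_olverSum (exists_continuation_of_add_eq_one hab c)).2
    (mem_ball_zero_iff.2 hz)

theorem deriv_regularizedF_eq {a b : ℂ} (hab : a + b = 1) (c : ℂ)
    {z : ℂ} (hz : ‖z‖ < 1) :
    deriv (regularizedF a b c) z = deriv (olverSum a b c) z :=
  ((eqOn_regularizedF_olverSum (exists_continuation_of_add_eq_one hab c)).2.eventuallyEq_of_mem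
    (Metric.isOpen_ball.mem_nhds (mem_ball_zero_iff.2 hz))).deriv_eq

theorem differentiableOn_deriv_regularizedF {a b : ℂ} (hab : a + b = 1) (c : ℂ)
    :
    DifferentiableOn ℂ (deriv (regularizedF a b c)) cutPlane :=
  (differentiableOn_regularizedF hab c).deriv isOpen_cutPlane

/-- This relation and the next three hold on the unit disk, where they compare coefficients of power
series, and persist on the cut plane by the identity theorem. -/
theorem regularizedF_lower {a b : ℂ} (hab : a + b = 1) (c : ℂ)
    {z : ℂ} (hz : z ∈ cutPlane) :
    z * deriv (regularizedF a b (c + 1)) z + c * regularizedF a b (c + 1) z =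
      regularizedF a b c z := by
  have h0 := differentiableOn_regularizedF hab c
  have h1 := differentiableOn_regularizedF hab (c + 1)
  have h2 := differentiableOn_deriv_regularizedF hab (c + 1)
  refine eqOn_cutPlane (f := fun z => z * deriv (regularizedF a b (c + 1)) z +
    c * regularizedF a b (c + 1) z) (by fun_prop) h0 (fun w hw => ?_) hz
  rw [deriv_regularizedF_eq hab _ hw, regularizedF_eq_olverSum hab _ hw,
    regularizedF_eq_olverSum hab _ hw, olverSum_lower a b c hw]

theorem regularizedF_raise {a b : ℂ} (hab : a + b = 1) (c : ℂ)
    {z : ℂ} (hz : z ∈ cutPlane) :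
    (1 - z) * (z * deriv (regularizedF a b c) z) =
      z * ((c - a) * (c - b) * regularizedF a b (c + 1) z + (1 - c) * regularizedF a b c z) := by
  have h0 := differentiableOn_regularizedF hab c
  have h1 := differentiableOn_regularizedF hab (c + 1)
  have h2 := differentiableOn_deriv_regularizedF hab c
  refine eqOn_cutPlane (f := fun z => (1 - z) * (z * deriv (regularizedF a b c) z))
    (g := fun z => z * ((c - a) * (c - b) * regularizedF a b (c + 1) z +
      (1 - c) * regularizedF a b c z)) (by fun_prop) (by fun_prop) (fun w hw => ?_) hz
  rw [deriv_regularizedF_eq hab _ hw, regularizedF_eq_olverSum hab _ hw,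
    regularizedF_eq_olverSum hab _ hw, olverSum_raise a b c hw, hab]

theorem regularizedF_legendre_succ (a c : ℂ) {z : ℂ} (hz : z ∈ cutPlane) :
    2 * (1 - z) * (z * deriv (regularizedF a (1 - a) c) z) =
      (a + c - 1) * regularizedF (a + 1) (-a) c z
        - (a * (1 - 2 * z) + c - 1) * regularizedF a (1 - a) c z := by
  have e0 : a + (1 - a) = 1 := by ring
  have e1 : a + 1 + -a = 1 := by ring
  have h0 := differentiableOn_regularizedF e0 c
  have h1 := differentiableOn_regularizedF e1 c
  have h2 := differentiableOn_deriv_regularizedF e0 c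
  refine eqOn_cutPlane (f := fun z => 2 * (1 - z) * (z * deriv (regularizedF a (1 - a) c) z))
    (g := fun z => (a + c - 1) * regularizedF (a + 1) (-a) c z
        - (a * (1 - 2 * z) + c - 1) * regularizedF a (1 - a) c z)
    (by fun_prop) (by fun_prop) (fun w hw => ?_) hz
  rw [deriv_regularizedF_eq e0 _ hw, regularizedF_eq_olverSum e0 _ hw,
    regularizedF_eq_olverSum e1 _ hw, olverSum_legendre_succ a c hw]

theorem regularizedF_legendre_pred (a c : ℂ) {z : ℂ} (hz : z ∈ cutPlane) :
    2 * (1 - z) * (z * deriv (regularizedF (a + 1) (-a) c) z) =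
      (a * (1 - 2 * z) + 1 - c) * regularizedF (a + 1) (-a) c z
        - (a + 1 - c) * regularizedF a (1 - a) c z := by
  have e0 : a + (1 - a) = 1 := by ring
  have e1 : a + 1 + -a = 1 := by ring
  have h0 := differentiableOn_regularizedF e0 c
  have h1 := differentiableOn_regularizedF e1 c
  have h2 := differentiableOn_deriv_regularizedF e1 c
  refine eqOn_cutPlane (f := fun z => 2 * (1 - z) * (z * deriv (regularizedF (a + 1) (-a) c) z))
    (g := fun z => (a * (1 - 2 * z) + 1 - c) * regularizedF (a + 1) (-a) c z
        - (a + 1 - c) * regularizedF a (1 - a) c z)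
    (by fun_prop) (by fun_prop) (fun w hw => ?_) hz
  rw [deriv_regularizedF_eq e1 _ hw, regularizedF_eq_olverSum e1 _ hw,
    regularizedF_eq_olverSum e0 _ hw, olverSum_legendre_pred a c hw]

theorem regularizedF_one_half {a b : ℂ} (hab : a + b = 1) (c : ℂ) :
    regularizedF a b c (1 / 2) = 2 ^ (1 - c) * (√Real.pi : ℂ) *
      ((Complex.Gamma ((c + a) / 2))⁻¹ * (Complex.Gamma ((c + b) / 2))⁻¹) := by
  obtain rfl : b = 1 - a := by rw [← hab]; ring
  rw [regularizedF_eq_olverSum hab c (by norm_num), olverSum_one_half, add_sub_assoc]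

theorem inv_mem_slitPlane {z : ℂ} (hz : z ∈ Complex.slitPlane) : z⁻¹ ∈ Complex.slitPlane := by
  have h0 := Complex.normSq_pos.2 (Complex.slitPlane_ne_zero hz)
  rw [Complex.mem_slitPlane_iff] at hz ⊢
  rw [Complex.inv_re, Complex.inv_im]
  exact hz.imp (fun h => div_pos h h0) fun h => div_ne_zero (neg_ne_zero.2 h) h0.ne'

theorem div_sub_one_mem_cutPlane {z : ℂ} (hz : z ∈ cutPlane) : z / (z - 1) ∈ cutPlane := by
  rw [mem_cutPlane_iff] at hz ⊢
  have h0 : z - 1 ≠ 0 := fun h => Complex.slitPlane_ne_zero hz (by rw [← neg_sub, h, neg_zero])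
  have h1 : 1 - z ≠ 0 := Complex.slitPlane_ne_zero hz
  have : 1 - z / (z - 1) = (1 - z)⁻¹ := by
    field_simp
    ring
  rw [this]
  exact inv_mem_slitPlane hz

/-- The right-hand side of **Pfaff's transformation** continues the series on the left to the cut
plane. -/
theorem pfaff_continuation {a b c : ℂ} (h : a + (c - b) = 1) :
    DifferentiableOn ℂ (fun z => (1 - z) ^ (-a) * regularizedF a (c - b) c (z / (z - 1))) cutPlane ∧
    EqOn (fun z => (1 - z) ^ (-a) * regularizedF a (c - b) c (z / (z - 1))) (olverSum a b c)
      (Metric.ball 0 1) := by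
  have hd : DifferentiableOn ℂ (fun z => (1 - z) ^ (-a) * regularizedF a (c - b) c (z / (z - 1)))
      cutPlane := by
    refine DifferentiableOn.mul ?_ ((differentiableOn_regularizedF h c).comp
      (g := regularizedF a (c - b) c) (f := fun z => z / (z - 1)) ?_
      fun z hz => div_sub_one_mem_cutPlane hz)
    · exact DifferentiableOn.cpow_const (by fun_prop) fun z hz => mem_cutPlane_iff.1 hz
    · refine DifferentiableOn.div (by fun_prop) (by fun_prop) fun z hz h0 => ?_
      exact Complex.slitPlane_ne_zero (mem_cutPlane_iff.1 hz) (by rw [← neg_sub, h0, neg_zero])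
  refine ⟨hd, ?_⟩
  refine ((hd.mono ball_subset_cutPlane).analyticOnNhd
    Metric.isOpen_ball).eqOn_of_preconnected_of_eventuallyEq
    ((differentiableOn_olverSum a b c).analyticOnNhd Metric.isOpen_ball)
    (convex_ball 0 1).isPreconnected (Metric.mem_ball_self one_pos) ?_
  filter_upwards [Metric.ball_mem_nhds (0 : ℂ) (ε := 1 / 3) (by norm_num)] with z hz
  rw [mem_ball_zero_iff] at hz
  rw [regularizedF_eq_olverSum h, pfaff_of_norm_lt a b c hz]
  have : 1 - ‖z‖ ≤ ‖z - 1‖ := by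
    rw [norm_sub_rev]; simpa using norm_sub_norm_le (1 : ℂ) z
  rw [norm_div, div_lt_one (by linarith)]
  linarith

/-! ### Linear differential systems -/

/-- A solution of a homogeneous linear system of two first-order equations on a star-shaped domain
vanishes if it vanishes at the centre (Grönwall along rays). -/
theorem linearSystem_eq_zero {S : Set ℂ} (hS : StarConvex ℝ 0 S) {k₁₁ k₁₂ k₂₁ k₂₂ X Y : ℂ → ℂ}
    (h₁₁ : ContinuousOn k₁₁ S) (h₁₂ : ContinuousOn k₁₂ S) (h₂₁ : ContinuousOn k₂₁ S)
    (h₂₂ : ContinuousOn k₂₂ S)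
    (hX : ∀ z ∈ S, HasDerivAt X (k₁₁ z * X z + k₁₂ z * Y z) z)
    (hY : ∀ z ∈ S, HasDerivAt Y (k₂₁ z * X z + k₂₂ z * Y z) z)
    (hX0 : X 0 = 0) (hY0 : Y 0 = 0) {z : ℂ} (hz : z ∈ S) : X z = 0 := by
  have hmem : ∀ t ∈ Icc (0 : ℝ) 1, (t : ℂ) * z ∈ S := fun t ht => by
    rw [← Complex.real_smul]
    exact starConvex_zero_iff.1 hS hz ht.1 ht.2
  have hbd : ∀ k : ℂ → ℂ, ContinuousOn k S → ∃ C : ℝ, ∀ t ∈ Icc (0 : ℝ) 1, ‖k (t * z)‖ ≤ C :=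
    fun k hk => isCompact_Icc.exists_bound_of_continuousOn
      (hk.comp (f := fun t : ℝ => (t : ℂ) * z) (by fun_prop) hmem)
  obtain ⟨C₁, hC₁⟩ := hbd _ h₁₁
  obtain ⟨C₂, hC₂⟩ := hbd _ h₁₂
  obtain ⟨C₃, hC₃⟩ := hbd _ h₂₁
  obtain ⟨C₄, hC₄⟩ := hbd _ h₂₂
  have hline : ∀ t : ℝ, HasDerivAt (fun t : ℝ => (t : ℂ) * z) z t := fun t => by
    simpa using (hasDerivAt_id t).ofReal_comp.mul_const z
  have hd : ∀ t ∈ Icc (0 : ℝ) 1, HasDerivAt (fun t : ℝ => (X (t * z), Y (t * z)))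
      ((k₁₁ (t * z) * X (t * z) + k₁₂ (t * z) * Y (t * z)) * z,
        (k₂₁ (t * z) * X (t * z) + k₂₂ (t * z) * Y (t * z)) * z) t := fun t ht =>
    ((hX _ (hmem t ht)).comp t (hline t)).prodMk ((hY _ (hmem t ht)).comp t (hline t))
  have key : ∀ {p q x y : ℂ} {P Q : ℝ}, ‖p‖ ≤ P → ‖q‖ ≤ Q →
      ‖(p * x + q * y) * z‖ ≤ (P + Q) * ‖z‖ * ‖(x, y)‖ := by
    intro p q x y P Q hp hq
    have hP := (norm_nonneg p).trans hp
    have hQ := (norm_nonneg q).trans hq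
    have hx : ‖x‖ ≤ ‖(x, y)‖ := norm_fst_le (x, y)
    have hy : ‖y‖ ≤ ‖(x, y)‖ := norm_snd_le (x, y)
    calc ‖(p * x + q * y) * z‖ ≤ (‖p‖ * ‖x‖ + ‖q‖ * ‖y‖) * ‖z‖ := by
          rw [norm_mul]
          gcongr
          exact (norm_add_le _ _).trans_eq (by rw [norm_mul, norm_mul])
      _ ≤ (P * ‖(x, y)‖ + Q * ‖(x, y)‖) * ‖z‖ := by gcongr
      _ = _ := by ring
  have h := eq_zero_of_abs_deriv_le_mul_abs_self_of_eq_zero_right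
    (f := fun t : ℝ => (X (t * z), Y (t * z)))
    (K := max ((C₁ + C₂) * ‖z‖) ((C₃ + C₄) * ‖z‖)) (a := 0) (b := 1)
    (fun t ht => (hd t ht).continuousAt.continuousWithinAt)
    (fun t ht => (hd t (Ico_subset_Icc_self ht)).hasDerivWithinAt)
    (by simp [hX0, hY0]) (fun t ht => by
      have ht' := Ico_subset_Icc_self ht
      rw [max_mul_of_nonneg _ _ (norm_nonneg _), Prod.norm_mk]
      exact max_le_max (key (hC₁ t ht') (hC₂ t ht')) (key (hC₃ t ht') (hC₄ t ht')))
    1 ⟨zero_le_one, le_rfl⟩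
  simpa using congrArg Prod.fst h

/-! ### The strip of angles -/

/-- The strip `|Re φ| < π / 2`, which `sin` maps bijectively onto the complex plane cut along
`(-∞, -1]` and `[1, ∞)`. -/
def angleStrip : Set ℂ := {φ | |φ.re| < Real.pi / 2}

theorem starConvex_angleStrip : StarConvex ℝ 0 angleStrip := by
  rw [starConvex_zero_iff]
  intro φ hφ t ht0 ht1
  have h : |φ.re| < Real.pi / 2 := hφ
  change |(t • φ).re| < Real.pi / 2
  rw [Complex.smul_re, smul_eq_mul, abs_mul, abs_of_nonneg ht0]
  exact (mul_le_of_le_one_left (abs_nonneg _) ht1).trans_lt h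

theorem cos_re_pos {φ : ℂ} (hφ : φ ∈ angleStrip) : 0 < (Complex.cos φ).re := by
  have h : 0 < Real.cos φ.re := Real.cos_pos_of_mem_Ioo (abs_lt.1 hφ)
  have h2 := Real.cosh_pos φ.im
  have : (Complex.cos φ).re = Real.cos φ.re * Real.cosh φ.im := by
    rw [Complex.cos_eq]
    simp [← Complex.ofReal_cos, ← Complex.ofReal_sin, ← Complex.ofReal_cosh, ← Complex.ofReal_sinh]
  rw [this]
  positivity

theorem cos_ne_zero_of_mem {φ : ℂ} (hφ : φ ∈ angleStrip) : Complex.cos φ ≠ 0 := fun h => by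
  have := cos_re_pos hφ
  simp [h] at this

/-- On the strip `cos² φ` is never a nonpositive real number. -/
theorem cos_sq_ne_of_nonpos {φ : ℂ} (hφ : φ ∈ angleStrip) {r : ℝ} (hr : r ≤ 0) :
    Complex.cos φ ^ 2 ≠ r := by
  intro h
  have h1 := cos_re_pos hφ
  have hre := congrArg Complex.re h
  have him := congrArg Complex.im h
  rw [pow_two, Complex.mul_re, Complex.ofReal_re] at hre
  rw [pow_two, Complex.mul_im, Complex.ofReal_im] at him
  have him0 : (Complex.cos φ).im = 0 := by
    have : (Complex.cos φ).re * (Complex.cos φ).im = 0 := by linarith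
    exact (mul_eq_zero.1 this).resolve_left h1.ne'
  rw [him0] at hre
  nlinarith

theorem one_sub_sin_div_two_mem {φ : ℂ} (hφ : φ ∈ angleStrip) :
    (1 - Complex.sin φ) / 2 ∈ cutPlane := by
  rintro ⟨r, hr, h⟩
  have hr : (1 : ℝ) ≤ r := hr
  refine cos_sq_ne_of_nonpos hφ (r := 1 - (1 - 2 * r) ^ 2) (by nlinarith) ?_
  have hs : Complex.sin φ = 1 - 2 * r := by rw [h]; ring
  rw [Complex.cos_sq', hs]
  push_cast
  ring

theorem one_add_sin_ne_zero {φ : ℂ} (hφ : φ ∈ angleStrip) : 1 + Complex.sin φ ≠ 0 := fun h => by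
  apply cos_ne_zero_of_mem hφ
  have : Complex.cos φ ^ 2 = 0 := by
    rw [Complex.cos_sq']; linear_combination (1 - Complex.sin φ) * h
  simpa using this

theorem one_sub_sin_ne_zero {φ : ℂ} (hφ : φ ∈ angleStrip) : 1 - Complex.sin φ ≠ 0 := fun h => by
  apply cos_ne_zero_of_mem hφ
  have : Complex.cos φ ^ 2 = 0 := by
    rw [Complex.cos_sq']; linear_combination (1 + Complex.sin φ) * h
  simpa using this

theorem ratio_mem_slitPlane {φ : ℂ} (hφ : φ ∈ angleStrip) :
    (1 + Complex.sin φ) / (1 - Complex.sin φ) ∈ Complex.slitPlane := by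
  have h1 := one_sub_sin_ne_zero hφ
  have h2 := one_add_sin_ne_zero hφ
  -- if the quotient is a real number `r ≤ 0`, then `cos² φ = 4 r / (1 + r)²` is one as well
  by_contra h
  rw [Complex.mem_slitPlane_iff] at h
  push Not at h
  set r := ((1 + Complex.sin φ) / (1 - Complex.sin φ)).re with hr
  have hq : (1 + Complex.sin φ) / (1 - Complex.sin φ) = r :=
    Complex.ext (by simp [hr]) (by simpa using h.2)
  have hr1 : (1 + r : ℂ) ≠ 0 := by
    intro h0
    rw [div_eq_iff h1] at hq
    have : (2 : ℂ) = 0 := by linear_combination hq + (1 - Complex.sin φ) * h0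
    exact two_ne_zero this
  have hcos : Complex.cos φ ^ 2 = ((4 * r / (1 + r) ^ 2 : ℝ) : ℂ) := by
    have hs : Complex.sin φ = (r - 1) / (1 + r) := by
      rw [div_eq_iff h1] at hq
      rw [eq_div_iff hr1]
      linear_combination hq
    rw [Complex.cos_sq', hs]
    push_cast
    field_simp
    ring
  exact cos_sq_ne_of_nonpos hφ (div_nonpos_of_nonpos_of_nonneg (by linarith [h.1])
    (sq_nonneg _)) hcos

theorem one_sub_mul_tan_div_two_mem {φ ε : ℂ} (hφ : φ ∈ angleStrip) (hε : ε ^ 2 = -1) :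
    (1 - ε * Complex.tan φ) / 2 ∈ cutPlane := by
  rintro ⟨r, hr, h⟩
  have hr : (1 : ℝ) ≤ r := hr
  have hc := cos_ne_zero_of_mem hφ
  have ht : ε * Complex.tan φ = 1 - 2 * r := by rw [h]; ring
  have hrr : (1 - (1 - 2 * r) ^ 2 : ℝ) ≤ 0 := by nlinarith
  have h1 : Complex.cos φ ^ 2 * ((1 - (1 - 2 * r) ^ 2 : ℝ) : ℂ) = 1 := by
    have h2 : Complex.tan φ * Complex.cos φ = Complex.sin φ := Complex.tan_mul_cos hc
    push_cast
    rw [← ht]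
    linear_combination Complex.sin_sq_add_cos_sq φ - Complex.tan φ ^ 2 * Complex.cos φ ^ 2 * hε +
      (Complex.tan φ * Complex.cos φ + Complex.sin φ) * h2
  refine cos_sq_ne_of_nonpos hφ (inv_nonpos.2 hrr) ?_
  rw [Complex.ofReal_inv]
  exact eq_inv_of_mul_eq_one_left h1

/-! ### The Ferrers function as a solution -/

/-- The Ferrers function as a function of the angle `φ` with `sin φ = x`. -/
noncomputable def ferrersAngle (ν μ φ : ℂ) : ℂ :=
  ((1 + Complex.sin φ) / (1 - Complex.sin φ)) ^ (μ / 2) *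
    regularizedF (ν + 1) (-ν) (1 - μ) ((1 - Complex.sin φ) / 2)

/-- The Ferrers function of order `μ + 1` as a function of the angle. The additional factor
`((1 + sin φ) / (1 - sin φ)) ^ (1 / 2)` of its prefactor is written as `(1 + sin φ) / cos φ`, which
avoids comparing principal roots. -/
noncomputable def ferrersAngleSucc (ν μ φ : ℂ) : ℂ :=
  ((1 + Complex.sin φ) / (1 - Complex.sin φ)) ^ (μ / 2) *
    ((1 + Complex.sin φ) / Complex.cos φ *
      regularizedF (ν + 1) (-ν) (-μ) ((1 - Complex.sin φ) / 2))

theorem hasDerivAt_ratio_cpow (μ : ℂ) {φ : ℂ} (hφ : φ ∈ angleStrip) :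
    HasDerivAt (fun φ => ((1 + Complex.sin φ) / (1 - Complex.sin φ)) ^ (μ / 2))
      (((1 + Complex.sin φ) / (1 - Complex.sin φ)) ^ (μ / 2) * (μ / Complex.cos φ)) φ := by
  have h1 := one_sub_sin_ne_zero hφ
  have h2 := one_add_sin_ne_zero hφ
  have hc := cos_ne_zero_of_mem hφ
  have hs := Complex.hasDerivAt_sin φ
  have hq := ((hs.const_add 1).div (hs.const_sub 1) h1).cpow_const (c := μ / 2)
    (ratio_mem_slitPlane hφ)
  refine hq.congr_deriv ?_
  have hcc := Complex.sin_sq_add_cos_sq φ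
  rw [Pi.div_apply, Complex.cpow_sub _ _ (div_ne_zero h2 h1), Complex.cpow_one]
  generalize ((1 + Complex.sin φ) / (1 - Complex.sin φ)) ^ (μ / 2) = q
  field_simp
  linear_combination 2 * μ * q * hcc

theorem hasDerivAt_regularizedF_sin {ν : ℂ} (c : ℂ) {φ : ℂ} (hφ : φ ∈ angleStrip) :
    HasDerivAt (fun φ => regularizedF (ν + 1) (-ν) c ((1 - Complex.sin φ) / 2))
      (deriv (regularizedF (ν + 1) (-ν) c) ((1 - Complex.sin φ) / 2) * (-Complex.cos φ / 2)) φ :=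
  HasDerivAt.comp φ (hasDerivAt_regularizedF (by ring) c (one_sub_sin_div_two_mem hφ))
    (((Complex.hasDerivAt_sin φ).const_sub 1).div_const 2)

theorem hasDerivAt_ferrersAngle (ν μ : ℂ) {φ : ℂ} (hφ : φ ∈ angleStrip) :
    HasDerivAt (ferrersAngle ν μ)
      (-μ * Complex.tan φ * ferrersAngle ν μ φ + -1 * ferrersAngleSucc ν μ φ) φ := by
  have h1 := one_sub_sin_ne_zero hφ
  have hc := cos_ne_zero_of_mem hφ
  have hd := (hasDerivAt_ratio_cpow μ hφ).mul (hasDerivAt_regularizedF_sin (ν := ν) (1 - μ) hφ)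
  refine hd.congr_deriv ?_
  have hl := regularizedF_lower (a := ν + 1) (b := -ν) (by ring) (-μ) (one_sub_sin_div_two_mem hφ)
  rw [neg_add_eq_sub] at hl
  have hcc := Complex.sin_sq_add_cos_sq φ
  unfold ferrersAngle ferrersAngleSucc
  rw [Complex.tan_eq_sin_div_cos, ← hl]
  generalize ((1 + Complex.sin φ) / (1 - Complex.sin φ)) ^ (μ / 2) = q
  generalize regularizedF (ν + 1) (-ν) (1 - μ) ((1 - Complex.sin φ) / 2) = R
  generalize deriv (regularizedF (ν + 1) (-ν) (1 - μ)) ((1 - Complex.sin φ) / 2) = R'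
  field_simp
  linear_combination (-q * R') * hcc

theorem hasDerivAt_ferrersAngleSucc (ν μ : ℂ) {φ : ℂ} (hφ : φ ∈ angleStrip) :
    HasDerivAt (ferrersAngleSucc ν μ)
      ((ν + μ + 1) * (ν - μ) * ferrersAngle ν μ φ +
        (μ + 1) * Complex.tan φ * ferrersAngleSucc ν μ φ) φ := by
  have h1 := one_sub_sin_ne_zero hφ
  have hc := cos_ne_zero_of_mem hφ
  have hs := Complex.hasDerivAt_sin φ
  have hd := (hasDerivAt_ratio_cpow μ hφ).mul (((hs.const_add 1).div (Complex.hasDerivAt_cos φ)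
    hc).mul (hasDerivAt_regularizedF_sin (ν := ν) (-μ) hφ))
  refine hd.congr_deriv ?_
  have hl := regularizedF_raise (a := ν + 1) (b := -ν) (by ring) (-μ) (one_sub_sin_div_two_mem hφ)
  rw [mul_left_comm] at hl
  have hl := mul_left_cancel₀ (div_ne_zero h1 two_ne_zero) hl
  rw [neg_add_eq_sub] at hl
  have hcc := Complex.sin_sq_add_cos_sq φ
  unfold ferrersAngle ferrersAngleSucc
  rw [Complex.tan_eq_sin_div_cos]
  simp only [Pi.div_apply, Pi.mul_apply]
  generalize ((1 + Complex.sin φ) / (1 - Complex.sin φ)) ^ (μ / 2) = q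
  generalize regularizedF (ν + 1) (-ν) (1 - μ) ((1 - Complex.sin φ) / 2) = R at *
  generalize regularizedF (ν + 1) (-ν) (-μ) ((1 - Complex.sin φ) / 2) = S at *
  generalize deriv (regularizedF (ν + 1) (-ν) (-μ)) ((1 - Complex.sin φ) / 2) = S' at *
  field_simp
  linear_combination (-2 * q * Complex.cos φ ^ 2) * hl - 2 * μ * q * S * hcc

/-! ### The exponential solutions -/

/-- For `ε = i` or `ε = -i`, `a = μ + 1 / 2` and `b = 1 - a`, one of the two terms of the right-hand
side after Pfaff's transformation, up to a constant. The powers of `cos φ` from `(1 - x²) ^ (μ / 2)`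
and from Pfaff's transformation combine to the exponent `-1 / 2`. -/
noncomputable def whippleAngle (ε ν a b φ : ℂ) : ℂ :=
  Complex.cos φ ^ (-(1 / 2) : ℂ) * Complex.exp (-ε * (ν + 1 / 2) * φ) *
    regularizedF a b (ν + 3 / 2) ((1 - ε * Complex.tan φ) / 2)

/-- The derivative is arranged so that the relations shifting `(a, b)` apply to its last term. -/
theorem hasDerivAt_whippleAngle {ε : ℂ} (hε : ε ^ 2 = -1) (ν : ℂ) {a b : ℂ} (hab : a + b = 1)
    {φ : ℂ} (hφ : φ ∈ angleStrip) :
    HasDerivAt (whippleAngle ε ν a b)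
      (Complex.cos φ ^ (-(1 / 2) : ℂ) * Complex.exp (-ε * (ν + 1 / 2) * φ) *
        ((Complex.tan φ / 2 - ε * (ν + 1 / 2)) *
          regularizedF a b (ν + 3 / 2) ((1 - ε * Complex.tan φ) / 2) -
        ε * (2 * (1 - (1 - ε * Complex.tan φ) / 2) * ((1 - ε * Complex.tan φ) / 2 *
          deriv (regularizedF a b (ν + 3 / 2)) ((1 - ε * Complex.tan φ) / 2))))) φ := by
  have hc := cos_ne_zero_of_mem hφ
  have h1 := (Complex.hasDerivAt_cos φ).cpow_const (c := -(1 / 2))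
    (Complex.mem_slitPlane_iff.2 (Or.inl (cos_re_pos hφ)))
  have h2 : HasDerivAt (fun φ => Complex.exp (-ε * (ν + 1 / 2) * φ))
      (Complex.exp (-ε * (ν + 1 / 2) * φ) * (-ε * (ν + 1 / 2))) φ := by
    simpa using ((hasDerivAt_id φ).const_mul (-ε * (ν + 1 / 2))).cexp
  have h3 := HasDerivAt.comp φ
    (hasDerivAt_regularizedF hab (ν + 3 / 2) (one_sub_mul_tan_div_two_mem hφ hε))
    ((((Complex.hasDerivAt_tan hc).const_mul ε).const_sub 1).div_const 2)
  refine ((h1.mul h2).mul h3).congr_deriv ?_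
  have hcc := Complex.sin_sq_add_cos_sq φ
  rw [Complex.cpow_sub _ _ hc, Complex.cpow_one]
  simp only [Pi.mul_apply, Function.comp]
  rw [Complex.tan_eq_sin_div_cos]
  generalize Complex.cos φ ^ (-(1 / 2) : ℂ) = q
  generalize Complex.exp (-ε * (ν + 1 / 2) * φ) = e
  generalize regularizedF a b (ν + 3 / 2) ((1 - ε * (Complex.sin φ / Complex.cos φ)) / 2) = R
  generalize deriv (regularizedF a b (ν + 3 / 2))
    ((1 - ε * (Complex.sin φ / Complex.cos φ)) / 2) = R'
  field_simp
  linear_combination (ε * R' * q * e) * hcc - (ε * R' * q * e) * Complex.sin φ ^ 2 * hε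

theorem hasDerivAt_whippleAngle_order {ε : ℂ} (hε : ε ^ 2 = -1) (ν μ : ℂ) {φ : ℂ}
    (hφ : φ ∈ angleStrip) :
    HasDerivAt (whippleAngle ε ν (μ + 1 / 2) (1 - (μ + 1 / 2)))
      (-μ * Complex.tan φ * whippleAngle ε ν (μ + 1 / 2) (1 - (μ + 1 / 2)) φ +
        -1 * ((ν + μ + 1) * ε * whippleAngle ε ν (μ + 1 / 2 + 1) (-(μ + 1 / 2)) φ)) φ := by
  refine (hasDerivAt_whippleAngle hε ν (by ring) hφ).congr_deriv ?_
  rw [regularizedF_legendre_succ _ _ (one_sub_mul_tan_div_two_mem hφ hε)]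
  unfold whippleAngle
  generalize Complex.cos φ ^ (-(1 / 2) : ℂ) = q
  generalize Complex.exp (-ε * (ν + 1 / 2) * φ) = e
  generalize regularizedF (μ + 1 / 2) (1 - (μ + 1 / 2)) (ν + 3 / 2) _ = R
  linear_combination (q * e * (μ + 1 / 2) * Complex.tan φ * R) * hε

theorem hasDerivAt_whippleAngle_order_succ {ε : ℂ} (hε : ε ^ 2 = -1) (ν μ : ℂ) {φ : ℂ}
    (hφ : φ ∈ angleStrip) :
    HasDerivAt (fun φ => (ν + μ + 1) * ε * whippleAngle ε ν (μ + 1 / 2 + 1) (-(μ + 1 / 2)) φ)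
      ((ν + μ + 1) * (ν - μ) * whippleAngle ε ν (μ + 1 / 2) (1 - (μ + 1 / 2)) φ +
        (μ + 1) * Complex.tan φ *
          ((ν + μ + 1) * ε * whippleAngle ε ν (μ + 1 / 2 + 1) (-(μ + 1 / 2)) φ)) φ := by
  refine ((hasDerivAt_whippleAngle hε ν (by ring) hφ).const_mul _).congr_deriv ?_
  rw [regularizedF_legendre_pred _ _ (one_sub_mul_tan_div_two_mem hφ hε)]
  unfold whippleAngle
  generalize Complex.cos φ ^ (-(1 / 2) : ℂ) = q
  generalize Complex.exp (-ε * (ν + 1 / 2) * φ) = e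
  generalize regularizedF (μ + 1 / 2) (1 - (μ + 1 / 2)) (ν + 3 / 2) _ = R
  generalize regularizedF (μ + 1 / 2 + 1) (-(μ + 1 / 2)) (ν + 3 / 2) _ = S
  linear_combination ((ν + μ + 1) * q * e * (-ε * (μ + 1 / 2) * Complex.tan φ * S +
    (μ - ν) * R)) * hε

/-! ### Initial values and comparison -/

theorem I_cpow_sub_neg_I_cpow (s : ℂ) :
    Complex.I ^ s - (-Complex.I) ^ s = 2 * Complex.I * Complex.sin (Real.pi * s / 2) := by
  rw [Complex.cpow_def_of_ne_zero Complex.I_ne_zero,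
    Complex.cpow_def_of_ne_zero (neg_ne_zero.2 Complex.I_ne_zero), Complex.log_I,
    Complex.log_neg_I, Complex.sin,
    show Real.pi / 2 * Complex.I * s = Real.pi * s / 2 * Complex.I by ring,
    show -(Real.pi / 2) * Complex.I * s = -(Real.pi * s / 2) * Complex.I by ring]
  linear_combination (Complex.exp (Real.pi * s / 2 * Complex.I) -
    Complex.exp (-(Real.pi * s / 2) * Complex.I)) * Complex.I_sq

/-- The two sides agree at `φ = 0`: both hypergeometric functions are taken at `1 / 2`, and Bailey's
theorem reduces the claim to the duplication and reflection formulas of the Gamma function. -/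
theorem initial_value {ν μ : ℂ} (hνμ : ∀ n : ℕ, ν + μ + 1 ≠ -n) :
    Complex.Gamma (ν + μ + 1) * (Complex.I ^ (ν + μ + 1) - (-Complex.I) ^ (ν + μ + 1)) *
      regularizedF (μ + 1 / 2) (1 - (μ + 1 / 2)) (ν + 3 / 2) (1 / 2) =
    2 ^ (1 / 2 : ℂ) * (Complex.I * (√Real.pi : ℂ)) *
      regularizedF (ν + 1) (-ν) (1 - μ) (1 / 2) := by
  rw [I_cpow_sub_neg_I_cpow, regularizedF_one_half (by ring), regularizedF_one_half (by ring),
    sub_sub_cancel]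
  set s := ν + μ + 1 with hs
  have hD := Complex.Gamma_mul_Gamma_add_half (s / 2)
  have hR := Complex.Gamma_mul_Gamma_one_sub (s / 2)
  rw [mul_div_cancel₀ _ two_ne_zero] at hD
  rw [show (ν + 3 / 2 + (μ + 1 / 2)) / 2 = s / 2 + 1 / 2 by rw [hs]; ring,
    show (1 - μ + -ν) / 2 = 1 - s / 2 by rw [hs]; ring,
    show (1 - μ + (ν + 1)) / 2 = (ν + 3 / 2 + (1 - (μ + 1 / 2))) / 2 by ring]
  have hg : Complex.Gamma (s / 2) ≠ 0 := by
    refine Complex.Gamma_ne_zero fun n h => hνμ (2 * n) ?_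
    push_cast
    linear_combination 2 * h
  have hg' : Complex.Gamma (s / 2 + 1 / 2) ≠ 0 := by
    refine Complex.Gamma_ne_zero fun n h => hνμ (2 * n + 1) ?_
    push_cast
    linear_combination 2 * h
  have hpi : (√Real.pi : ℂ) * (√Real.pi : ℂ) = Real.pi := by
    rw [← Complex.ofReal_mul, Real.mul_self_sqrt Real.pi_nonneg]
  -- the reflection formula solved for `1 / Γ(1 - s / 2)`, also valid at the poles
  have hR' : (Complex.Gamma (1 - s / 2))⁻¹ * Real.pi =
      Complex.Gamma (s / 2) * Complex.sin (Real.pi * s / 2) := by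
    have hp : (Real.pi : ℂ) ≠ 0 := Complex.ofReal_ne_zero.2 Real.pi_ne_zero
    rw [← mul_div_assoc] at hR
    by_cases h0 : Complex.Gamma (1 - s / 2) = 0
    · rw [h0, mul_zero, eq_comm, div_eq_zero_iff] at hR
      rw [h0, hR.resolve_left hp]
      simp
    · have hsin : Complex.sin (Real.pi * s / 2) ≠ 0 := fun h => by
        rw [h, div_zero] at hR
        exact mul_ne_zero hg h0 hR
      rw [eq_div_iff hsin] at hR
      rw [inv_mul_eq_iff_eq_mul₀ h0]
      linear_combination -hR
  have hP : (2 : ℂ) * 2 ^ (1 - (ν + 3 / 2)) = 2 ^ (1 / 2 : ℂ) * 2 ^ μ * 2 ^ (1 - s) := by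
    rw [← Complex.cpow_add _ _ two_ne_zero, ← Complex.cpow_add _ _ two_ne_zero]
    nth_rewrite 1 [← Complex.cpow_one (2 : ℂ)]
    rw [← Complex.cpow_add _ _ two_ne_zero, hs]
    ring_nf
  have hA := mul_inv_cancel₀ hg'
  have hT : (2 : ℂ) ^ (1 - s) ≠ 0 := by simp [Complex.cpow_eq_zero_iff]
  have hr : (√Real.pi : ℂ) ≠ 0 :=
    Complex.ofReal_ne_zero.2 (Real.sqrt_ne_zero'.2 Real.pi_pos)
  refine mul_right_cancel₀ (mul_ne_zero hT hr) ?_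
  generalize (Complex.Gamma ((ν + 3 / 2 + (1 - (μ + 1 / 2))) / 2))⁻¹ = y at *
  generalize (Complex.Gamma (1 - s / 2))⁻¹ = x at *
  generalize (Complex.Gamma (s / 2 + 1 / 2))⁻¹ = a at *
  generalize (2 : ℂ) ^ (1 - (ν + 3 / 2)) = E at *
  generalize (√Real.pi : ℂ) = r at *
  linear_combination (-(2 * Complex.I * Complex.sin (Real.pi * s / 2) * E * r * a * y)) * hD +
    (Complex.Gamma (s / 2) * Complex.sin (Real.pi * s / 2) * 2 * Complex.I * E * r * y) * hA -
    (2 * E * Complex.I * r * y) * hR' + (x * Real.pi * Complex.I * r * y) * hP -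
    (2 ^ (1 / 2 : ℂ) * 2 ^ μ * 2 ^ (1 - s) * x * Complex.I * r * y) * hpi

theorem whippleAngle_zero (ε ν a b : ℂ) :
    whippleAngle ε ν a b 0 = regularizedF a b (ν + 3 / 2) (1 / 2) := by
  simp [whippleAngle]

theorem continuousOn_tan_angleStrip : ContinuousOn Complex.tan angleStrip := fun _ hφ =>
  (Complex.hasDerivAt_tan (cos_ne_zero_of_mem hφ)).continuousAt.continuousWithinAt

/-- The Ferrers function as a combination of the two exponential solutions. -/
theorem ferrersAngle_eq {ν μ : ℂ} (hνμ : ∀ n : ℕ, ν + μ + 1 ≠ -n) {φ : ℂ} (hφ : φ ∈ angleStrip) :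
    ferrersAngle ν μ φ =
      Complex.Gamma (ν + μ + 1) / (2 ^ (1 / 2 : ℂ) * (Complex.I * (√Real.pi : ℂ))) *
        (Complex.I ^ (ν + μ + 1) *
            whippleAngle Complex.I ν (μ + 1 / 2) (1 - (μ + 1 / 2)) φ -
          (-Complex.I) ^ (ν + μ + 1) *
            whippleAngle (-Complex.I) ν (μ + 1 / 2) (1 - (μ + 1 / 2)) φ) := by
  have hr : (√Real.pi : ℂ) ≠ 0 :=
    Complex.ofReal_ne_zero.2 (Real.sqrt_ne_zero'.2 Real.pi_pos)
  have h2 : (2 : ℂ) ^ (1 / 2 : ℂ) ≠ 0 := by simp [Complex.cpow_eq_zero_iff]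
  have hI := Complex.I_sq
  have hI' : (-Complex.I) ^ 2 = -1 := by rw [neg_sq, hI]
  have hs0 : ν + μ + 1 ≠ 0 := by simpa using hνμ 0
  have i1 := initial_value hνμ
  -- the initial value of `Y` is that of `X` with `μ + 1` in place of `μ`
  have i2 := initial_value (ν := ν) (μ := μ + 1) fun n h => hνμ (n + 1) (by
    push_cast; linear_combination h)
  rw [show ν + (μ + 1) + 1 = ν + μ + 1 + 1 by ring, Complex.Gamma_add_one _ hs0,
    Complex.cpow_add _ _ Complex.I_ne_zero,
    Complex.cpow_add _ _ (neg_ne_zero.2 Complex.I_ne_zero), Complex.cpow_one, Complex.cpow_one,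
    show μ + 1 + 1 / 2 = μ + 1 / 2 + 1 by ring, show 1 - (μ + 1 / 2 + 1) = -(μ + 1 / 2) by ring,
    show 1 - (μ + 1) = -μ by ring] at i2
  set k := Complex.Gamma (ν + μ + 1) / (2 ^ (1 / 2 : ℂ) * (Complex.I * (√Real.pi : ℂ))) with hk
  have hk' : Complex.Gamma (ν + μ + 1) = k * (2 ^ (1 / 2 : ℂ) * (Complex.I * (√Real.pi : ℂ))) := by
    rw [hk, div_mul_cancel₀]
    exact mul_ne_zero h2 (mul_ne_zero Complex.I_ne_zero hr)
  have hK : (2 : ℂ) ^ (1 / 2 : ℂ) * (Complex.I * (√Real.pi : ℂ)) ≠ 0 :=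
    mul_ne_zero h2 (mul_ne_zero Complex.I_ne_zero hr)
  rw [hk'] at i1 i2
  clear_value k
  set p := Complex.I ^ (ν + μ + 1)
  set q := (-Complex.I) ^ (ν + μ + 1)
  have htan := continuousOn_tan_angleStrip
  refine sub_eq_zero.1 (linearSystem_eq_zero starConvex_angleStrip
    (k₁₁ := fun φ => -μ * Complex.tan φ) (k₁₂ := fun _ => -1)
    (k₂₁ := fun _ => (ν + μ + 1) * (ν - μ)) (k₂₂ := fun φ => (μ + 1) * Complex.tan φ)
    (X := fun φ => ferrersAngle ν μ φ - k *
      (p * whippleAngle Complex.I ν (μ + 1 / 2) (1 - (μ + 1 / 2)) φ -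
        q * whippleAngle (-Complex.I) ν (μ + 1 / 2) (1 - (μ + 1 / 2)) φ))
    (Y := fun φ => ferrersAngleSucc ν μ φ - k *
      (p * ((ν + μ + 1) * Complex.I *
          whippleAngle Complex.I ν (μ + 1 / 2 + 1) (-(μ + 1 / 2)) φ) -
        q * ((ν + μ + 1) * -Complex.I *
          whippleAngle (-Complex.I) ν (μ + 1 / 2 + 1) (-(μ + 1 / 2)) φ)))
    (by fun_prop) (by fun_prop) (by fun_prop) (by fun_prop) (fun z hz => ?_) (fun z hz => ?_)
    ?_ ?_ hφ)
  · refine ((hasDerivAt_ferrersAngle ν μ hz).sub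
      ((((hasDerivAt_whippleAngle_order hI ν μ hz).const_mul p).sub
        ((hasDerivAt_whippleAngle_order hI' ν μ hz).const_mul q)).const_mul k)).congr_deriv ?_
    ring
  · refine ((hasDerivAt_ferrersAngleSucc ν μ hz).sub
      ((((hasDerivAt_whippleAngle_order_succ hI ν μ hz).const_mul p).sub
        ((hasDerivAt_whippleAngle_order_succ hI' ν μ hz).const_mul q)).const_mul k)).congr_deriv ?_
    ring
  · refine mul_left_cancel₀ hK ?_
    simp only [whippleAngle_zero, ferrersAngle, Complex.sin_zero, add_zero, sub_zero, div_one,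
      Complex.one_cpow, one_mul]
    linear_combination -i1
  · refine mul_left_cancel₀ hK ?_
    simp only [whippleAngle_zero, ferrersAngleSucc, Complex.sin_zero, Complex.cos_zero, add_zero,
      sub_zero, div_one, Complex.one_cpow, one_mul]
    linear_combination -i2

/-! ### Principal powers -/

/-- The product law of principal powers, which holds as long as the arguments add up to less than
`π` in absolute value. -/
theorem mul_exp_cpow {x w : ℂ} (hx : x ≠ 0) (h : |x.arg + w.im| < Real.pi) (p : ℂ) :
    (x * Complex.exp w) ^ p = x ^ p * Complex.exp (w * p) := by
  have hl : Complex.log (x * Complex.exp w) = Complex.log x + w := by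
    rw [abs_lt] at h
    nth_rewrite 1 [← Complex.exp_log hx]
    rw [← Complex.exp_add, Complex.log_exp] <;> rw [Complex.add_im, Complex.log_im] <;> linarith
  rw [Complex.cpow_def_of_ne_zero (mul_ne_zero hx (Complex.exp_ne_zero w)),
    Complex.cpow_def_of_ne_zero hx, hl, add_mul, Complex.exp_add]

theorem two_mul_cpow {y : ℂ} (hy : 0 < y.re) (p : ℂ) : (2 * y) ^ p = 2 ^ p * y ^ p := by
  have hy0 : y ≠ 0 := fun h => by simp [h] at hy
  have harg := Complex.abs_arg_lt_pi_div_two_iff.2 (Or.inl hy)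
  have h := mul_exp_cpow (x := 2) (w := Complex.log y) two_ne_zero (by
    rw [Complex.log_im, show (2 : ℂ) = ((2 : ℝ) : ℂ) by norm_num,
      Complex.arg_ofReal_of_nonneg zero_le_two, zero_add]
    linarith [Real.pi_pos]) p
  rwa [Complex.exp_log hy0, ← Complex.cpow_def_of_ne_zero hy0] at h

/-- One of the two terms of the right-hand side, for `ε = i` or `ε = -i`, rewritten by Pfaff's
transformation. Here `e = exp (-ε φ)`, and the argument of the hypergeometric function is
`-e ^ 2`. -/
theorem unit_cpow_mul_regularizedF {ε φ : ℂ} (hφ : φ ∈ angleStrip) (hε : ε ^ 2 = -1)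
    (harg : |ε.arg| ≤ Real.pi / 2) (him : |(-ε * φ).im| < Real.pi / 2)
    (hcos : 2 * Complex.cos φ = Complex.exp (-ε * φ) + (Complex.exp (-ε * φ))⁻¹)
    (hsin : 2 * ε * Complex.sin φ = (Complex.exp (-ε * φ))⁻¹ - Complex.exp (-ε * φ)) :
    -Complex.exp (-ε * φ) ^ 2 ∈ cutPlane ∧ ∀ ν μ : ℂ,
    (∃ g : ℂ → ℂ, DifferentiableOn ℂ g cutPlane ∧
      EqOn g (olverSum (μ + 1 / 2) (ν + μ + 1) (ν + 3 / 2)) (Metric.ball 0 1)) ∧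
    (ε * Complex.exp (-ε * φ)) ^ (ν + μ + 1) *
        regularizedF (μ + 1 / 2) (ν + μ + 1) (ν + 3 / 2) (-Complex.exp (-ε * φ) ^ 2) =
      2 ^ (-(μ + 1 / 2)) * Complex.cos φ ^ (-μ) *
        (ε ^ (ν + μ + 1) * whippleAngle ε ν (μ + 1 / 2) (1 - (μ + 1 / 2)) φ) := by
  have hc := cos_ne_zero_of_mem hφ
  have he := Complex.exp_ne_zero (-ε * φ)
  have hε0 : ε ≠ 0 := fun h => by simp [h] at hε
  have hargc := Complex.abs_arg_lt_pi_div_two_iff.2 (Or.inl (cos_re_pos hφ))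
  have hw := one_sub_mul_tan_div_two_mem hφ hε
  set e := Complex.exp (-ε * φ) with hedef
  have h1 : 1 - -e ^ 2 = 2 * Complex.cos φ * e := by
    rw [hcos]; field_simp; ring
  have hne : 1 + e ^ 2 ≠ 0 := by
    rw [sub_neg_eq_add] at h1
    rw [h1]
    exact mul_ne_zero (mul_ne_zero two_ne_zero hc) he
  have hwe : (1 - ε * Complex.tan φ) / 2 = e ^ 2 / (1 + e ^ 2) := by
    have : 2 * (Complex.cos φ - ε * Complex.sin φ) = 2 * e := by linear_combination hcos - hsin
    rw [← sub_neg_eq_add 1 (e ^ 2), h1, Complex.tan_eq_sin_div_cos]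
    field_simp
    linear_combination this / 2
  have hz : -e ^ 2 ∈ cutPlane := by
    have := div_sub_one_mem_cutPlane hw
    rwa [hwe, show e ^ 2 / (1 + e ^ 2) / (e ^ 2 / (1 + e ^ 2) - 1) = -e ^ 2 by
      have : e ^ 2 / (1 + e ^ 2) - 1 = -1 / (1 + e ^ 2) := by field_simp; ring
      rw [this]; field_simp] at this
  refine ⟨hz, fun ν μ => ?_⟩
  have hpf := pfaff_continuation (a := μ + 1 / 2) (b := ν + μ + 1) (c := ν + 3 / 2) (by ring)
  refine ⟨⟨_, hpf⟩, ?_⟩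
  have hwz : -e ^ 2 / (-e ^ 2 - 1) = (1 - ε * Complex.tan φ) / 2 := by
    rw [hwe, ← neg_add', neg_div_neg_eq, add_comm]
  have e1 : (ε * e) ^ (ν + μ + 1) = ε ^ (ν + μ + 1) * Complex.exp (-ε * φ * (ν + μ + 1)) :=
    mul_exp_cpow hε0 ((abs_add_le _ _).trans_lt (by linarith)) _
  have e2 : (2 * Complex.cos φ * e) ^ (-(μ + 1 / 2)) =
      2 ^ (-(μ + 1 / 2)) * Complex.cos φ ^ (-(μ + 1 / 2)) *
        Complex.exp (-ε * φ * (-(μ + 1 / 2))) := by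
    rw [← two_mul_cpow (cos_re_pos hφ)]
    refine mul_exp_cpow (mul_ne_zero two_ne_zero hc) ((abs_add_le _ _).trans_lt ?_) _
    rw [show (2 : ℂ) = ((2 : ℝ) : ℂ) by norm_num, Complex.arg_real_mul _ two_pos]
    linarith
  have e3 : Complex.exp (-ε * φ * (ν + μ + 1)) * Complex.exp (-ε * φ * (-(μ + 1 / 2))) =
      Complex.exp (-ε * (ν + 1 / 2) * φ) := by
    rw [← Complex.exp_add]; ring_nf
  have e4 : Complex.cos φ ^ (-(μ + 1 / 2)) =
      Complex.cos φ ^ (-μ) * Complex.cos φ ^ (-(1 / 2) : ℂ) := by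
    rw [← Complex.cpow_add _ _ hc]; ring_nf
  rw [regularizedF_eqOn hpf.1 hpf.2 hz, whippleAngle, ← e3]
  simp only
  rw [hwz, h1, e1, e2, e4, show ν + 3 / 2 - (ν + μ + 1) = 1 - (μ + 1 / 2) by ring]
  ring

/-! ### The angle of a point -/

theorem log_mul_half_im (z : ℂ) : (Complex.log z * (1 / 2)).im = z.arg / 2 := by
  rw [mul_one_div, Complex.div_ofNat_im, Complex.log_im]

theorem cpow_half_re_pos {z : ℂ} (hz : z ∈ Complex.slitPlane) : 0 < (z ^ (1 / 2 : ℂ)).re := by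
  have h1 := Complex.neg_pi_lt_arg z
  have h2 := lt_of_le_of_ne (Complex.arg_le_pi z) (Complex.slitPlane_arg_ne_pi hz)
  rw [Complex.cpow_def_of_ne_zero (Complex.slitPlane_ne_zero hz), Complex.exp_re, log_mul_half_im]
  exact mul_pos (Real.exp_pos _) (Real.cos_pos_of_mem_Ioo ⟨by linarith, by linarith⟩)

theorem one_sub_sq_mem_slitPlane {x : ℂ} (hx : x ∉ ((↑) : ℝ → ℂ) '' (Iic (-1) ∪ Ici 1)) :
    1 - x ^ 2 ∈ Complex.slitPlane := by
  by_contra h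
  rw [Complex.mem_slitPlane_iff] at h
  push Not at h
  obtain ⟨h1, h2⟩ := h
  simp only [pow_two, Complex.sub_re, Complex.one_re, Complex.mul_re, Complex.sub_im,
    Complex.one_im, Complex.mul_im] at h1 h2
  have h3 : x.re * x.im = 0 := by linarith
  rcases mul_eq_zero.1 h3 with h3 | h3
  · rw [h3] at h1; nlinarith
  · refine hx ⟨x.re, ?_, Complex.ext (by simp) (by simp [h3])⟩
    rw [h3] at h1
    by_contra hn
    simp only [mem_union, mem_Iic, mem_Ici, not_or, not_le] at hn
    nlinarith

/-- Every point of the doubly cut plane is the sine of an angle in the strip, and there the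
principal square root `√(1 - x²)` is the cosine. -/
theorem exists_angle {x : ℂ} (hx : x ∉ ((↑) : ℝ → ℂ) '' (Iic (-1) ∪ Ici 1)) :
    ∃ φ ∈ angleStrip, Complex.sin φ = x ∧ Complex.cos φ = (1 - x ^ 2) ^ (1 / 2 : ℂ) := by
  set s := (1 - x ^ 2) ^ (1 / 2 : ℂ) with hs
  have hs2 : s ^ 2 = 1 - x ^ 2 := by
    rw [hs, one_div, Complex.cpow_ofNat_inv_pow]
  have hre : 0 < s.re := cpow_half_re_pos (one_sub_sq_mem_slitPlane hx)
  -- `w = exp (-i φ)`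
  set w := s - Complex.I * x with hw
  have hinv : w * (s + Complex.I * x) = 1 := by
    rw [hw]; linear_combination hs2 - x ^ 2 * Complex.I_sq
  have hw0 : w ≠ 0 := left_ne_zero_of_mul_eq_one hinv
  have hwinv : w⁻¹ = s + Complex.I * x := inv_eq_of_mul_eq_one_right hinv
  have hwre : 0 < w.re := by
    have h1 : (w + w⁻¹).re = 2 * s.re := by rw [hwinv, hw]; simp; ring
    rw [Complex.add_re, Complex.inv_re] at h1
    have h2 := Complex.normSq_pos.2 hw0
    by_contra hn
    have : w.re / Complex.normSq w ≤ 0 := div_nonpos_of_nonpos_of_nonneg (not_lt.1 hn) h2.le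
    linarith
  have h1 : Complex.exp (-(Complex.I * Complex.log w) * Complex.I) = w := by
    rw [show -(Complex.I * Complex.log w) * Complex.I = Complex.log w by
      linear_combination -Complex.log w * Complex.I_sq, Complex.exp_log hw0]
  have h2 : Complex.exp (Complex.I * Complex.log w * Complex.I) = w⁻¹ := by
    rw [show Complex.I * Complex.log w * Complex.I = -Complex.log w by
      linear_combination Complex.log w * Complex.I_sq, Complex.exp_neg, Complex.exp_log hw0]
  refine ⟨Complex.I * Complex.log w, ?_, ?_, ?_⟩
  · change |(Complex.I * Complex.log w).re| < _
    rw [Complex.I_mul_re, abs_neg, Complex.log_im]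
    exact Complex.abs_arg_lt_pi_div_two_iff.2 (Or.inl hwre)
  · rw [Complex.sin, h1, h2, hwinv, hw]
    linear_combination -x * Complex.I_sq
  · rw [Complex.cos, h1, h2, hwinv, hw]
    ring

theorem theorem1 (x ν μ u v : ℂ)
    (hx : x ∉ ((↑) : ℝ → ℂ) '' (Set.Iic (-1) ∪ Set.Ici 1))
    (hνμ : ∀ n : ℕ, 1 ≤ n → ν + μ ≠ -(n : ℂ))
    (hu : u = x + Complex.I * (1 - x ^ 2) ^ (1 / 2 : ℂ))
    (hv : v = x - Complex.I * (1 - x ^ 2) ^ (1 / 2 : ℂ)) :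
    v = 1 / u ∧ u / v ∈ cutPlane ∧ v / u ∈ cutPlane ∧
    ((∀ n : ℕ, ν + 3 / 2 ≠ -(n : ℂ)) →
      ferrersP ν μ x =
        2 ^ μ / (Complex.I * ((Real.sqrt Real.pi : ℝ) : ℂ)) * (1 - x ^ 2) ^ (1 / 2 * μ) *
          (Complex.Gamma (ν + μ + 1) / Complex.Gamma (ν + 3 / 2)) *
          (u ^ (ν + μ + 1) * gaussF (μ + 1 / 2) (ν + μ + 1) (ν + 3 / 2) (u / v) -
            v ^ (ν + μ + 1) * gaussF (μ + 1 / 2) (ν + μ + 1) (ν + 3 / 2) (v / u))) ∧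
    ferrersP ν μ x =
      2 ^ μ / (Complex.I * ((Real.sqrt Real.pi : ℝ) : ℂ)) * (1 - x ^ 2) ^ (1 / 2 * μ) *
        Complex.Gamma (ν + μ + 1) *
        (u ^ (ν + μ + 1) * regularizedF (μ + 1 / 2) (ν + μ + 1) (ν + 3 / 2) (u / v) -
          v ^ (ν + μ + 1) * regularizedF (μ + 1 / 2) (ν + μ + 1) (ν + 3 / 2) (v / u)) := by
  obtain ⟨φ, hφ, hsin, hcos⟩ := exists_angle hx
  have hφ' : |φ.re| < Real.pi / 2 := hφ
  have hc := cos_ne_zero_of_mem hφ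
  have hI := Complex.I_sq
  have hI0 := Complex.I_ne_zero
  have hinv : (Complex.exp (-Complex.I * φ))⁻¹ = Complex.exp (- -Complex.I * φ) := by
    rw [← Complex.exp_neg]; ring_nf
  have hce : 2 * Complex.cos φ =
      Complex.exp (-Complex.I * φ) + (Complex.exp (-Complex.I * φ))⁻¹ := by
    rw [hinv, Complex.cos]; ring_nf
  have hse : 2 * Complex.I * Complex.sin φ =
      (Complex.exp (-Complex.I * φ))⁻¹ - Complex.exp (-Complex.I * φ) := by
    rw [hinv, Complex.sin, show -φ * Complex.I = -Complex.I * φ by ring,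
      show φ * Complex.I = - -Complex.I * φ by ring]
    linear_combination (Complex.exp (-Complex.I * φ) - Complex.exp (- -Complex.I * φ)) * hI
  set e := Complex.exp (-Complex.I * φ) with hedef
  have he : e ≠ 0 := Complex.exp_ne_zero _
  have hue : u = Complex.I * e := by
    rw [hu, ← hcos, ← hsin]
    linear_combination Complex.I / 2 * hce - Complex.I / 2 * hse + Complex.sin φ * hI
  have hve : v = -Complex.I * e⁻¹ := by
    rw [hv, ← hcos, ← hsin]
    linear_combination -Complex.I / 2 * hce - Complex.I / 2 * hse + Complex.sin φ * hI
  have huv : u / v = -e ^ 2 := by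
    rw [hue, hve]; field_simp
  have hvu : v / u = -(e⁻¹) ^ 2 := by
    rw [hue, hve]; field_simp
  obtain ⟨hz1, ht1⟩ := unit_cpow_mul_regularizedF (ε := Complex.I) hφ hI
    (by rw [Complex.arg_I, abs_of_pos (by positivity)])
    (by simpa using hφ') hce hse
  obtain ⟨hz2, ht2⟩ := unit_cpow_mul_regularizedF (ε := -Complex.I) hφ (by rw [neg_sq, hI])
    (by rw [Complex.arg_neg_I, abs_neg, abs_of_pos (by positivity)])
    (by simpa using hφ') (by rw [← hinv, inv_inv, hce, add_comm])
    (by rw [← hinv, inv_inv]; linear_combination -hse)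
  rw [← hinv] at hz2 ht2
  rw [← hedef] at hz1 ht1
  rw [← huv] at hz1
  rw [← hvu] at hz2
  obtain ⟨hcont, ht1⟩ := ht1 ν μ
  obtain ⟨-, ht2⟩ := ht2 ν μ
  rw [← huv, ← hue] at ht1
  rw [← hvu, ← hve] at ht2
  have hνμ' : ∀ n : ℕ, ν + μ + 1 ≠ -n := fun n h => hνμ (n + 1) (by omega) (by
    push_cast; linear_combination h)
  have hpow : (1 - x ^ 2) ^ (1 / 2 * μ) = Complex.cos φ ^ μ := by
    have h1 := Complex.neg_pi_lt_arg (1 - x ^ 2)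
    have h2 := Complex.arg_le_pi (1 - x ^ 2)
    rw [hcos, Complex.cpow_mul] <;> rw [log_mul_half_im] <;> linarith [Real.pi_pos]
  have hreg : ferrersP ν μ x =
      2 ^ μ / (Complex.I * ((Real.sqrt Real.pi : ℝ) : ℂ)) * (1 - x ^ 2) ^ (1 / 2 * μ) *
        Complex.Gamma (ν + μ + 1) *
        (u ^ (ν + μ + 1) * regularizedF (μ + 1 / 2) (ν + μ + 1) (ν + 3 / 2) (u / v) -
          v ^ (ν + μ + 1) * regularizedF (μ + 1 / 2) (ν + μ + 1) (ν + 3 / 2) (v / u)) := by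
    have hF := ferrersAngle_eq hνμ' hφ
    rw [ferrersAngle, hsin] at hF
    rw [ferrersP, hF, ht1, ht2, hpow, Complex.cpow_neg _ μ, neg_add, Complex.cpow_add _ _ two_ne_zero,
      Complex.cpow_neg _ μ, Complex.cpow_neg _ (1 / 2)]
    have p1 : Complex.cos φ ^ μ ≠ 0 := by simp [Complex.cpow_eq_zero_iff, hc]
    have p2 : (2 : ℂ) ^ μ ≠ 0 := by simp [Complex.cpow_eq_zero_iff]
    have p3 : (2 : ℂ) ^ (1 / 2 : ℂ) ≠ 0 := by simp [Complex.cpow_eq_zero_iff]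
    field_simp
  refine ⟨?_, hz1, hz2, fun hc0 => ?_, hreg⟩
  · rw [hue, hve, one_div, mul_inv, Complex.inv_I]
  · have hG := Complex.Gamma_ne_zero hc0
    rw [hreg, gaussF_eq_Gamma_mul_regularizedF hcont hc0 hz1,
      gaussF_eq_Gamma_mul_regularizedF hcont hc0 hz2]
    generalize Complex.Gamma (ν + 3 / 2) = G at *
    field_simp
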